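/- For $n\ge 0$ let $\mathfrak D_n$ be the group of permutations $\pi$ of $\{\pm1,\dots,\pm n\}$ with $\pi(-i)=-\pi(i)$ for all $i$ and with an even number of negative entries among $\pi_1,\dots,\pi_n$, where $\pi_i=\pi(i)$ (so $\pi_{-1}=-\pi_1$). For $n\ge 2$, an index $i\in\{-1,1,2,\dots,n-1\}$ is a type D descent of $\pi$ if $\pi_i>\pi_{|i|+1}$ and a type D ascent if $\pi_i<\pi_{|i|+1}$. Let $\mathrm{edes}_D,\mathrm{odes}_D,\mathrm{easc}_D,\mathrm{oasc}_D$ be the numbers of even-indexed descents, odd-indexed descents, even-indexed ascents and odd-indexed ascents (the index $-1$ is odd), and $\mathrm{inv}_D(\pi)=|\{1\le i<j\le n:\pi_i>\pi_j\}|+|\{1\le i<j\le n:-\pi_i>\pi_j\}|$. Put $$D_n(s_0,s_1,t_0,t_1,q)=\sum_{\pi\in\mathfrak D_n}s_0^{\mathrm{easc}_D(\pi)}s_1^{\mathrm{oasc}_D(\pi)}t_0^{\mathrm{edes}_D(\pi)}t_1^{\mathrm{odes}_D(\pi)}q^{\mathrm{inv}_D(\pi)},\qquad D_n(1,q)=\sum_{\pi\in\mathfrak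 D_n}q^{\mathrm{inv}_D(\pi)},$$ $$\mathcal D_0(s_0,s_1,t_0,t_1,q,u)=\sum_{k\ge1}D_{2k}(s_0,s_1,t_0,t_1,q)\frac{u^{2k}}{D_{2k}(1,q)},\qquad \mathcal D_1(s_0,s_1,t_0,t_1,q,u)=\sum_{k\ge1}D_{2k+1}(s_0,s_1,t_0,t_1,q)\frac{u^{2k+1}}{D_{2k+1}(1,q)}.$$ With $[n]_q=1+q+\dots+q^{n-1}$ and $[n]_q!=\prod_{i=1}^n[i]_q$, let $\mathrm e_q(u)=\sum_{n\ge0}u^n/[n]_q!$ and $\exp_D(u;q)=\sum_{n\ge0}u^n/D_n(1,q)$, and let $\cosh_q,\sinh_q$ and $\cosh_D(\cdot;q),\sinh_D(\cdot;q)$ be their even and odd parts. For $M=\sqrt{(1-s)(1-t)}$ let $$\mathrm{OD}=ut^2(\cosh_q(Mu)-1)+\frac{(1-t)M}{1-s}(\sinh_D(Mu;q)-Mu)+\frac{2t(1-t)}{M}(\sinh_q(Mu)-Mu),$$ $$\mathrm{ED}=2t(\cosh_q(Mu)-1)+(1-t)(\cosh_D(Mu;q)-1)+\frac{ut^2(1-s)}{M}\sinh_q(Mu).$$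 Let $K$ be a field of characteristic $0$ and $s_0,s_1,t_0,t_1,q\in K$ with $s_0,s_1\ne0$, $s_0\ne t_0$, $s_1\ne t_1$ and $[n]_q\neq0$ for all $n\ge1$ (for example, independent indeterminates in a suitable field). Suppose that $K$ contains square roots $r=\sqrt{s_0s_1}$ and $m=\sqrt{(s_0-t_0)(s_1-t_1)}$; any choice of the two roots is allowed. Let $T$ be the substitution $s\mapsto t_0/s_0$, $t\mapsto t_1/s_1$, $u\mapsto ru$, $M\mapsto m/r$ (so that $Mu\mapsto mu$). Then $D_n(1,q)\ne0$ for all $n$, the series $$\Delta=s_0s_1-(s_0t_1+s_1t_0)\cosh_q(mu)+t_0t_1\,\mathrm e_q(mu)\,\mathrm e_q(-mu)$$ is invertible in $K[[u]]$, and in $K[[u]]$ $$\mathcal D_0(s_0,s_1,t_0,t_1,q,u)=\frac{s_1\Big[T(\mathrm{ED})\,\big(s_1-t_1\cosh_q(mu)\big)+T(\mathrm{OD})\,\frac{t_1(s_0-t_0)\,r}{m\,s_0}\sinh_q(mu)\Big]}{\Delta},$$ $$\mathcal D_1(s_0,s_1,t_0,t_1,q,u)=\frac{\frac{s_1r}{s_0}\,T(\mathrm{OD})\,\big(s_0-t_0\cosh_q(mu)\big)+T(\mathrm{ED})\,\frac{s_1t_0(s_1-t_1)}{m}\sinh_q(mu)}{\Delta},$$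 where, explicitly, $$T(\mathrm{OD})=\frac{r\,u\,t_1^2}{s_1^2}(\cosh_q(mu)-1)+\frac{s_0(s_1-t_1)m}{s_1(s_0-t_0)r}(\sinh_D(mu;q)-mu)+\frac{2t_1(s_1-t_1)r}{s_1^2m}(\sinh_q(mu)-mu),$$ $$T(\mathrm{ED})=\frac{2t_1}{s_1}(\cosh_q(mu)-1)+\frac{u\,t_1^2(s_0-t_0)}{s_1m}\sinh_q(mu)+\frac{s_1-t_1}{s_1}(\cosh_D(mu;q)-1).$$ -/

import Mathlib

namespace TypeD

open PowerSeries

/-- A signed permutation of `[±n]` in window notation: the underlying permutation of `[n]` together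
with the sign of each entry. -/
abbrev SignedPerm (n : ℕ) : Type := Equiv.Perm (Fin n) × (Fin n → ℤˣ)

namespace SignedPerm

variable {n : ℕ}

/-- The value `π_i = π(i)` for an index `i ∈ [±n]`: for `1 ≤ i ≤ n` it is the signed entry in
position `i` (positions and values of `Fin n` are shifted by one), and `π(-i) = -π(i)`.
It is `0` outside `[±n]`. -/
def val (π : SignedPerm n) (i : ℤ) : ℤ :=
  if h : 1 ≤ i.natAbs ∧ i.natAbs ≤ n then
    i.sign * ((π.2 ⟨i.natAbs - 1, by omega⟩ : ℤˣ) : ℤ) *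
      (((π.1 ⟨i.natAbs - 1, by omega⟩ : Fin n) : ℕ) + 1 : ℤ)
  else 0

/-- The indices `{-1, 1, 2, …, n - 1}` at which type D descents and ascents are read; an index `i`
compares `π_i` with `π_{|i|+1}`. -/
noncomputable def indices (n : ℕ) : Finset ℤ :=
  (Finset.Icc (-1) ((n : ℤ) - 1)).filter fun i => i ≠ 0 ∧ |i| + 1 ≤ (n : ℤ)

/-- The type D descent set. -/
noncomputable def desSet (π : SignedPerm n) : Finset ℤ :=
  (indices n).filter fun i => π.val i > π.val (|i| + 1)

/-- The type D ascent set. -/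
noncomputable def ascSet (π : SignedPerm n) : Finset ℤ :=
  (indices n).filter fun i => π.val i < π.val (|i| + 1)

/-- Number of type D descents. -/
noncomputable def des (π : SignedPerm n) : ℕ := π.desSet.card

/-- Number of even-indexed type D descents. -/
noncomputable def edes (π : SignedPerm n) : ℕ := (π.desSet.filter fun i => Even i).card

/-- Number of odd-indexed type D descents (the index `-1` is odd). -/
noncomputable def odes (π : SignedPerm n) : ℕ := (π.desSet.filter fun i => Odd i).card

/-- Number of even-indexed type D ascents. -/
noncomputable def easc (π : SignedPerm n) : ℕ := (π.ascSet.filter fun i => Even i).card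

/-- Number of odd-indexed type D ascents (the index `-1` is odd). -/
noncomputable def oasc (π : SignedPerm n) : ℕ := (π.ascSet.filter fun i => Odd i).card

/-- The pairs of positions `(i, j)` with `1 ≤ i < j ≤ n`. -/
noncomputable def pairs (n : ℕ) : Finset (ℤ × ℤ) :=
  (Finset.Icc (1 : ℤ) n ×ˢ Finset.Icc (1 : ℤ) n).filter fun p => p.1 < p.2

/-- The type D length `inv_D`. -/
noncomputable def inv (π : SignedPerm n) : ℕ :=
  ((pairs n).filter fun p => π.val p.1 > π.val p.2).card +
    ((pairs n).filter fun p => -π.val p.1 > π.val p.2).card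

end SignedPerm

/-- The Coxeter group `𝔇_n`: signed permutations with an even number of negative entries. -/
noncomputable def group (n : ℕ) : Finset (SignedPerm n) :=
  Finset.univ.filter fun π =>
    Even ((Finset.Icc (1 : ℤ) n).filter fun i => π.val i < 0).card

section Series

variable {K : Type*} [Field K]

/-- `D_n(t, q)`, the sum of `t^{des_D} q^{inv_D}` over `𝔇_n`. -/
noncomputable def eulerian (n : ℕ) (t q : K) : K :=
  ∑ π ∈ group n, t ^ π.des * q ^ π.inv

/-- The five-variable distribution `D_n(s₀, s₁, t₀, t₁, q)`. -/
noncomputable def fiveVar (n : ℕ) (s₀ s₁ t₀ t₁ q : K) : K :=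
  ∑ π ∈ group n, s₀ ^ π.easc * s₁ ^ π.oasc * t₀ ^ π.edes * t₁ ^ π.odes * q ^ π.inv

/-- The even part of the egf, `∑_{k ≥ 1} D_{2k}(s₀, s₁, t₀, t₁, q) u^{2k} / D_{2k}(1, q)`. -/
noncomputable def egfEven (s₀ s₁ t₀ t₁ q : K) : K⟦X⟧ :=
  PowerSeries.mk fun n =>
    if Even n ∧ 2 ≤ n then fiveVar n s₀ s₁ t₀ t₁ q / eulerian n 1 q else 0

/-- The odd part of the egf,
`∑_{k ≥ 1} D_{2k+1}(s₀, s₁, t₀, t₁, q) u^{2k+1} / D_{2k+1}(1, q)`. -/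
noncomputable def egfOdd (s₀ s₁ t₀ t₁ q : K) : K⟦X⟧ :=
  PowerSeries.mk fun n =>
    if Odd n ∧ 3 ≤ n then fiveVar n s₀ s₁ t₀ t₁ q / eulerian n 1 q else 0

/-- The `q`-integer `[n]_q = 1 + q + ⋯ + q^{n-1}`. -/
def qInt (q : K) (n : ℕ) : K := ∑ i ∈ Finset.range n, q ^ i

/-- The `q`-factorial `[n]_q!`. -/
def qFact (q : K) (n : ℕ) : K := ∏ i ∈ Finset.Icc 1 n, qInt q i

/-- `e_q(u) = ∑ u^n / [n]_q!`. -/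
def expq (q : K) : K⟦X⟧ := PowerSeries.mk fun n => 1 / qFact q n

/-- `exp_D(u; q) = ∑ u^n / D_n(1, q)`. -/
noncomputable def expD (q : K) : K⟦X⟧ := PowerSeries.mk fun n => 1 / eulerian n 1 q

/-- `(f(u) + f(-u)) / 2`. -/
noncomputable def evenPart (f : K⟦X⟧) : K⟦X⟧ := C (1 / 2 : K) * (f + rescale (-1 : K) f)

/-- `(f(u) - f(-u)) / 2`. -/
noncomputable def oddPart (f : K⟦X⟧) : K⟦X⟧ := C (1 / 2 : K) * (f - rescale (-1 : K) f)

/-- `cosh_q`. -/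
noncomputable def coshq (q : K) : K⟦X⟧ := evenPart (expq q)

/-- `sinh_q`. -/
noncomputable def sinhq (q : K) : K⟦X⟧ := oddPart (expq q)

/-- `cosh_D(·; q)`. -/
noncomputable def coshD (q : K) : K⟦X⟧ := evenPart (expD q)

/-- `sinh_D(·; q)`. -/
noncomputable def sinhD (q : K) : K⟦X⟧ := oddPart (expD q)

/-- The bivariate series `ED`, as a power series in `u`; here `M` stands for a square root of
`(1 - s)(1 - t)`. -/
noncomputable def ED (s t q M : K) : K⟦X⟧ :=
  C (2 * t) * (rescale M (coshq q) - 1) + C (1 - t) * (rescale M (coshD q) - 1) +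
    C (t ^ 2 * (1 - s) / M) * X * rescale M (sinhq q)

/-- The bivariate series `OD`, as a power series in `u`; here `M` stands for a square root of
`(1 - s)(1 - t)`. -/
noncomputable def OD (s t q M : K) : K⟦X⟧ :=
  C (t ^ 2) * X * (rescale M (coshq q) - 1) +
    C ((1 - t) * M / (1 - s)) * (rescale M (sinhD q) - C M * X) +
    C (2 * t * (1 - t) / M) * (rescale M (sinhq q) - C M * X)

/-- `T(ED)`: the substitution `s ↦ t₀/s₀`, `t ↦ t₁/s₁`, `u ↦ r u` in `ED`, where `r` is a square
root of `s₀ s₁`. For a square root `m` of `(s₀ - t₀)(s₁ - t₁)`, it turns `M` into `m / r`. -/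
noncomputable def TED (s₀ s₁ t₀ t₁ q r m : K) : K⟦X⟧ :=
  rescale r (ED (t₀ / s₀) (t₁ / s₁) q (m / r))

/-- `T(OD)`: the same substitution in `OD`. -/
noncomputable def TOD (s₀ s₁ t₀ t₁ q r m : K) : K⟦X⟧ :=
  rescale r (OD (t₀ / s₀) (t₁ / s₁) q (m / r))

/-- The common denominator
`s₀s₁ - (s₀t₁ + s₁t₀) cosh_q(mu) + t₀t₁ e_q(mu) e_q(-mu)`. -/
noncomputable def denom (s₀ s₁ t₀ t₁ q m : K) : K⟦X⟧ :=
  C (s₀ * s₁) - C (s₀ * t₁ + s₁ * t₀) * rescale m (coshq q) +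
    C (t₀ * t₁) * (rescale m (expq q) * rescale (-m) (expq q))

end Series

end TypeD

namespace TypeD

open Finset SignedPerm PowerSeries

/-! Give each index `i` the weight `t_i + c_i·[ascent at i]`, where `c_i = s_i - t_i` and the
subscripts of `s` and `t` are read by parity. Expand the factors with `i ≥ 2` by the last index `k`
whose factor contributes `t_k` (the last cut). What remains is a weighted word on the first `k`
entries followed by `n - k` increasing entries. Requiring the tail to increase divides the `q`-count
by `[n-k]_q!`, and the prefix weight depends only on the pattern of the first `k` entries. So after
division by `D_n(1,q)` this cut contributes `D_k / D_k(1,q) · t_k · ∏_{k<i<n} c_i / [n-k]_q!`. If no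
cut occurs at `i ≥ 2`, the two indices `±1` leave four terms: `t₁²/[n-1]_q!`, twice `t₁c₁/[n]_q!`,
and `c₁²/D_n(1,q)`, each times `∏_{2≤i<n} c_i`. The resulting recurrence is `fiveVar_div_eulerian`.

The counting is done over all signed permutations, where the last entry can be removed freely.
Negating the entry `±1` changes neither `inv_D` nor any type D ascent but flips the parity of the
number of negative entries, so each such sum is twice the sum over `𝔇_n`.

Since `m² = c₀c₁`, products of consecutive `c_i` are powers of `m` up to one factor fixed by parity.
The recurrence thus becomes two linear equations for the even and odd series, with coefficients in
`cosh_q(mu)` and `sinh_q(mu)` (`egfEven_eq`, `egfOdd_eq`). Cramer's rule solves them, and `cosh_q² -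
sinh_q² = e_q(mu) e_q(-mu)` turns the determinant into `Δ`. -/

/-! ### Signed permutations as words of integers -/

theorem sum_Icc_one_int {M : Type*} [AddCommMonoid M] (n : ℕ) (f : ℤ → M) :
    ∑ x ∈ Icc (1 : ℤ) n, f x = ∑ i : Fin n, f ((i : ℕ) + 1) := by
  symm
  refine sum_bij (fun i _ => ((i : ℕ) : ℤ) + 1) ?_ ?_ ?_ ?_
  · intro i _
    have := i.2
    simp only [mem_Icc]
    omega
  · intro i _ j _ h
    ext
    omega
  · intro x hx
    simp only [mem_Icc] at hx
    exact ⟨⟨(x - 1).toNat, by omega⟩, mem_univ _, by simp; omega⟩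
  · intros
    rfl

namespace SignedPerm

variable {n : ℕ}

/-- The signed entry in a position. -/
def entry (π : SignedPerm n) (i : Fin n) : ℤ := (π.2 i : ℤ) * ((π.1 i : ℕ) + 1)

theorem val_succ (π : SignedPerm n) (i : Fin n) : π.val ((i : ℕ) + 1 : ℤ) = π.entry i := by
  have h : (((i : ℕ) : ℤ) + 1).natAbs = i + 1 := by omega
  have hs : (((i : ℕ) : ℤ) + 1).sign = 1 := Int.sign_eq_one_of_pos (by omega)
  have hi := i.2
  unfold val entry
  rw [dif_pos (by omega)]
  simp only [h, hs, one_mul, Nat.add_sub_cancel]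

theorem val_neg (π : SignedPerm n) (i : ℤ) : π.val (-i) = -π.val i := by
  unfold val
  simp only [Int.natAbs_neg, Int.sign_neg]
  split_ifs <;> ring

theorem natAbs_entry (π : SignedPerm n) (i : Fin n) : (π.entry i).natAbs = π.1 i + 1 := by
  unfold entry
  rw [Int.natAbs_mul, Int.units_natAbs]
  omega

theorem entry_ne_of_ne (π : SignedPerm n) {i j : Fin n} (h : i ≠ j) :
    (π.entry i).natAbs ≠ (π.entry j).natAbs := by
  rw [natAbs_entry, natAbs_entry]
  intro h'
  exact h (π.1.injective (Fin.ext (by omega)))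

theorem entry_injective (π : SignedPerm n) : Function.Injective π.entry := by
  intro i j h
  by_contra hij
  exact π.entry_ne_of_ne hij (by rw [h])

end SignedPerm

/-- Type D inversions of a word of integers. -/
def wordInv {n : ℕ} (e : Fin n → ℤ) : ℕ :=
  ∑ j, ∑ i, if i < j then (if e j < e i then 1 else 0) + (if e j < -e i then 1 else 0) else 0

theorem inv_eq_wordInv {n : ℕ} (π : SignedPerm n) : π.inv = wordInv π.entry := by
  unfold SignedPerm.inv pairs wordInv
  rw [card_filter, card_filter, ← sum_add_distrib, sum_filter, sum_product, sum_Icc_one_int, sum_comm]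
  simp only [sum_Icc_one_int, val_succ]
  refine sum_comm.trans ?_
  rw [sum_comm]
  refine sum_congr rfl fun j _ => sum_congr rfl fun i _ => ?_
  have h : ((i : ℕ) : ℤ) + 1 < (j : ℕ) + 1 ↔ i < j := by
    rw [Fin.lt_def]
    omega
  simp only [h, gt_iff_lt]

/-! ### Removing the last entry -/

/-- The permutation with last value `p` whose other values have the pattern `σ`. -/
def insertLast {n : ℕ} (p : Fin (n + 1)) (σ : Equiv.Perm (Fin n)) : Equiv.Perm (Fin (n + 1)) :=
  (finSuccEquiv' (Fin.last n)).trans ((Equiv.optionCongr σ).trans (finSuccEquiv' p).symm)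

theorem insertLast_last {n : ℕ} (p : Fin (n + 1)) (σ : Equiv.Perm (Fin n)) :
    insertLast p σ (Fin.last n) = p := by
  simp [insertLast]

theorem insertLast_castSucc {n : ℕ} (p : Fin (n + 1)) (σ : Equiv.Perm (Fin n)) (i : Fin n) :
    insertLast p σ i.castSucc = p.succAbove (σ i) := by
  have h : i.castSucc = (Fin.last n).succAbove i := by simp
  rw [insertLast, h]
  simp only [Equiv.trans_apply, finSuccEquiv'_succAbove]
  simp

theorem insertLast_bijective (n : ℕ) :
    Function.Bijective fun x : Fin (n + 1) × Equiv.Perm (Fin n) => insertLast x.1 x.2 := by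
  rw [Fintype.bijective_iff_injective_and_card]
  constructor
  · rintro ⟨p, σ⟩ ⟨p', σ'⟩ h
    have hp : p = p' := by
      rw [← insertLast_last p σ, ← insertLast_last p' σ']
      exact congrArg (fun τ : Equiv.Perm (Fin (n + 1)) => τ (Fin.last n)) h
    subst hp
    congr 1
    ext i
    have h' := congrArg (fun τ : Equiv.Perm (Fin (n + 1)) => τ i.castSucc) h
    simp only [insertLast_castSucc] at h'
    rw [Fin.succAbove_right_injective h']
  · simp [Fintype.card_perm, Nat.factorial_succ]

/-- The signed permutation with last entry `ε (p + 1)` whose other entries have the pattern `σ`. -/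
def SignedPerm.insertLast {n : ℕ} (p : Fin (n + 1)) (ε : ℤˣ) (σ : SignedPerm n) :
    SignedPerm (n + 1) :=
  (TypeD.insertLast p σ.1, Fin.snoc (α := fun _ => ℤˣ) σ.2 ε)

theorem SignedPerm.insertLast_bijective (n : ℕ) :
    Function.Bijective fun x : (Fin (n + 1) × ℤˣ) × SignedPerm n =>
      SignedPerm.insertLast x.1.1 x.1.2 x.2 := by
  rw [Fintype.bijective_iff_injective_and_card]
  constructor
  · rintro ⟨⟨p, ε⟩, σ⟩ ⟨⟨p', ε'⟩, σ'⟩ h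
    simp only [SignedPerm.insertLast, Prod.mk.injEq] at h
    have h1 := @(TypeD.insertLast_bijective n).1 (p, σ.1) (p', σ'.1) h.1
    have h2 := Fin.snoc_injective2 h.2
    simp only [Prod.mk.injEq] at h1
    ext1
    · exact Prod.ext h1.1 h2.2
    · exact Prod.ext h1.2 h2.1
  · simp [Fintype.card_perm, Nat.factorial_succ, pow_succ]
    ring

theorem entry_insertLast_last {n : ℕ} (p : Fin (n + 1)) (ε : ℤˣ) (σ : SignedPerm n) :
    (SignedPerm.insertLast p ε σ).entry (Fin.last n) = ε * ((p : ℕ) + 1) := by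
  simp [entry, SignedPerm.insertLast, TypeD.insertLast_last]

theorem entry_insertLast_castSucc {n : ℕ} (p : Fin (n + 1)) (ε : ℤˣ) (σ : SignedPerm n)
    (i : Fin n) : (SignedPerm.insertLast p ε σ).entry i.castSucc =
      σ.2 i * ((p.succAbove (σ.1 i) : ℕ) + 1) := by
  simp [entry, SignedPerm.insertLast, TypeD.insertLast_castSucc]

/-- The order of two signed numbers depends only on their signs and the relative order of their
absolute values, so standardising the earlier entries preserves every comparison. -/
theorem unit_mul_lt_iff (ε δ : ℤˣ) {a b a' b' : ℕ} (h : a < b ↔ a' < b') (h' : b < a ↔ b' < a') :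
    (ε : ℤ) * (a + 1) < δ * (b + 1) ↔ (ε : ℤ) * (a' + 1) < δ * (b' + 1) := by
  rcases Int.units_eq_one_or ε with rfl | rfl <;> rcases Int.units_eq_one_or δ with rfl | rfl <;>
    push_cast <;> omega

theorem insertLast_unit_lt_iff {n : ℕ} (p : Fin (n + 1)) (ε δ : ℤˣ) (a b : Fin n) :
    (ε : ℤ) * ((p.succAbove a : ℕ) + 1) < δ * ((p.succAbove b : ℕ) + 1) ↔
      (ε : ℤ) * ((a : ℕ) + 1) < δ * ((b : ℕ) + 1) := by
  refine unit_mul_lt_iff ε δ ?_ ?_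
  · exact (Fin.strictMono_succAbove p).lt_iff_lt
  · exact (Fin.strictMono_succAbove p).lt_iff_lt

theorem entry_insertLast_lt {n : ℕ} (p : Fin (n + 1)) (ε : ℤˣ) (σ : SignedPerm n) (i j : Fin n) :
    (SignedPerm.insertLast p ε σ).entry i.castSucc < (SignedPerm.insertLast p ε σ).entry j.castSucc
      ↔ σ.entry i < σ.entry j := by
  rw [entry_insertLast_castSucc, entry_insertLast_castSucc, insertLast_unit_lt_iff]
  rfl

theorem entry_insertLast_lt_neg {n : ℕ} (p : Fin (n + 1)) (ε : ℤˣ) (σ : SignedPerm n)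
    (i j : Fin n) :
    (SignedPerm.insertLast p ε σ).entry i.castSucc < -(SignedPerm.insertLast p ε σ).entry j.castSucc
      ↔ σ.entry i < -σ.entry j := by
  have h := insertLast_unit_lt_iff p (σ.2 i) (-σ.2 j) (σ.1 i) (σ.1 j)
  rw [entry_insertLast_castSucc, entry_insertLast_castSucc]
  simpa only [Units.val_neg, neg_mul, entry] using h

theorem sum_le_castSucc {n : ℕ} (p : Fin (n + 1)) :
    (∑ a : Fin n, if (p : ℕ) < p.succAbove a then 1 else 0) = n - p := by
  rw [← card_filter]
  have h : ∀ a : Fin n, (p : ℕ) < p.succAbove a ↔ p ≤ a.castSucc := fun a =>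
    Fin.lt_succAbove_iff_le_castSucc p a
  simp only [h, Fin.le_def, Fin.val_castSucc]
  have := Fin.sum_univ_eq_sum_range (fun a => if (p : ℕ) ≤ a then 1 else 0) n
  rw [card_filter, this, ← card_filter]
  have h2 : (range n).filter (fun a => (p : ℕ) ≤ a) = Ico (p : ℕ) n := by
    ext a
    simp
    omega
  rw [h2, Nat.card_Ico]

theorem sum_succAbove_lt {n : ℕ} (p : Fin (n + 1)) :
    (∑ a : Fin n, if (p.succAbove a : ℕ) < p then 1 else 0) = (p : ℕ) := by
  have h : (∑ a : Fin n, if (p.succAbove a : ℕ) < p then 1 else 0) +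
      (∑ a : Fin n, if (p : ℕ) < p.succAbove a then 1 else 0) = n := by
    rw [← sum_add_distrib]
    have : ∀ a : Fin n, ((if (p.succAbove a : ℕ) < p then 1 else 0) +
        (if (p : ℕ) < p.succAbove a then 1 else 0)) = 1 := by
      intro a
      have : (p.succAbove a : ℕ) ≠ p := fun h => Fin.succAbove_ne p a (Fin.ext h)
      split_ifs <;> omega
    rw [sum_congr rfl fun a _ => this a]
    simp
  rw [sum_le_castSucc] at h
  have := p.2
  omega

/-- The two indicators together are symmetric under negating the entry, so the signs of the earlier
entries drop out and only the set of their absolute values matters. -/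
theorem sum_lt_symm_entry {n : ℕ} (p : Fin (n + 1)) (ε : ℤˣ) (σ : SignedPerm n) (L : ℤ) :
    (∑ i : Fin n, ((if L < (SignedPerm.insertLast p ε σ).entry i.castSucc then 1 else 0) +
      (if L < -(SignedPerm.insertLast p ε σ).entry i.castSucc then 1 else 0))) =
    ∑ a : Fin n, ((if L < (p.succAbove a : ℕ) + 1 then 1 else 0) +
      (if L < -((p.succAbove a : ℕ) + 1) then 1 else 0)) := by
  rw [← Equiv.sum_comp σ.1 fun a => ((if L < (p.succAbove a : ℕ) + 1 then 1 else 0) +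
      (if L < -((p.succAbove a : ℕ) + 1 : ℤ) then 1 else 0))]
  refine sum_congr rfl fun i _ => ?_
  rw [entry_insertLast_castSucc]
  rcases Int.units_eq_one_or (σ.2 i) with h | h <;> rw [h] <;> push_cast
  · simp only [one_mul]
  · rw [add_comm]
    simp only [neg_mul, one_mul, neg_neg]

/-- A positive last entry is exceeded once by each of the `n - p` larger absolute values. A negative
one lies below all `n` absolute values, and also below the negatives of the `p` smaller ones. -/
theorem wordInv_insertLast {n : ℕ} (p : Fin (n + 1)) (ε : ℤˣ) (σ : SignedPerm n) :
    wordInv (SignedPerm.insertLast p ε σ).entry =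
      wordInv σ.entry + if ε = 1 then n - p else n + p := by
  have hL := sum_lt_symm_entry p ε σ ((SignedPerm.insertLast p ε σ).entry (Fin.last n))
  unfold wordInv
  rw [Fin.sum_univ_castSucc]
  congr 1
  · refine sum_congr rfl fun j _ => ?_
    rw [Fin.sum_univ_castSucc]
    simp only [entry_insertLast_lt, entry_insertLast_lt_neg, Fin.castSucc_lt_castSucc_iff]
    rw [if_neg (by exact not_lt.2 (Fin.le_last _)), add_zero]
  · rw [Fin.sum_univ_castSucc]
    simp only [Fin.castSucc_lt_last, if_true, lt_self_iff_false, if_false, add_zero]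
    rw [hL, entry_insertLast_last, sum_add_distrib]
    rcases Int.units_eq_one_or ε with rfl | rfl
    · rw [if_pos rfl, ← sum_le_castSucc p]
      have h1 : ∀ a : Fin n, ((1 : ℤˣ) : ℤ) * ((p : ℕ) + 1) < (p.succAbove a : ℕ) + 1 ↔
          (p : ℕ) < p.succAbove a := fun a => by push_cast; omega
      have h2 : ∀ a : Fin n, ¬ ((1 : ℤˣ) : ℤ) * ((p : ℕ) + 1) < -((p.succAbove a : ℕ) + 1) :=
        fun a => by push_cast; omega
      simp only [h1, h2, if_false, sum_const_zero, add_zero]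
    · rw [if_neg (by decide)]
      have h1 : ∀ a : Fin n, ((-1 : ℤˣ) : ℤ) * ((p : ℕ) + 1) < (p.succAbove a : ℕ) + 1 :=
        fun a => by push_cast; omega
      have h2 : ∀ a : Fin n, ((-1 : ℤˣ) : ℤ) * ((p : ℕ) + 1) < -((p.succAbove a : ℕ) + 1) ↔
          (p.succAbove a : ℕ) < p := fun a => by push_cast; omega
      rw [sum_congr rfl fun a _ => if_pos (h1 a)]
      simp only [h2, sum_succAbove_lt]
      simp

section Field

variable {K : Type*} [Field K]

theorem sum_units_int {M : Type*} [AddCommMonoid M] (f : ℤˣ → M) : ∑ ε, f ε = f 1 + f (-1) := by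
  rw [show (univ : Finset ℤˣ) = {1, -1} from rfl, sum_pair (by decide)]

theorem sum_pow_rev (q : K) (n : ℕ) : ∑ p : Fin (n + 1), q ^ (n - (p : ℕ)) = qInt q (n + 1) := by
  rw [Fin.sum_univ_eq_sum_range (fun p => q ^ (n - p)) (n + 1), qInt,
    ← sum_range_reflect]
  refine sum_congr rfl fun i hi => ?_
  rw [mem_range] at hi
  congr 1
  omega

/-- Summing over the last entry of a signed permutation. -/
theorem sum_pow_inv_succ {n : ℕ} (q : K) (F : SignedPerm n → K) (F' : SignedPerm (n + 1) → K)
    (h : ∀ p ε σ, F' (SignedPerm.insertLast p ε σ) = F σ) :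
    ∑ π, F' π * q ^ π.inv = qInt q (n + 1) * (1 + q ^ n) * ∑ σ, F σ * q ^ σ.inv := by
  rw [← Function.Bijective.sum_comp (SignedPerm.insertLast_bijective n), Fintype.sum_prod_type]
  simp only [h, inv_eq_wordInv, wordInv_insertLast, pow_add, ← mul_assoc]
  simp only [← sum_mul]
  rw [← mul_sum, mul_comm, Fintype.sum_prod_type]
  congr 1
  have h1 : ∀ p : Fin (n + 1), (if (-1 : ℤˣ) = 1 then n - (p : ℕ) else n + p) = n + p :=
    fun p => if_neg (by decide)
  simp only [sum_units_int, sum_add_distrib, if_true, sum_pow_rev, h1, pow_add, ← mul_sum]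
  rw [Fin.sum_univ_eq_sum_range (fun p => q ^ p) (n + 1), ← qInt]
  ring

end Field

/-! ### Rearranging and sorting the last entries -/

/-- The permutation of `Fin (k + m)` acting as `τ` on the last `m` positions. -/
def tailPerm (k : ℕ) {m : ℕ} (τ : Equiv.Perm (Fin m)) : Equiv.Perm (Fin (k + m)) :=
  finSumFinEquiv.permCongr (Equiv.Perm.sumCongr 1 τ)

theorem tailPerm_castAdd {k m : ℕ} (τ : Equiv.Perm (Fin m)) (i : Fin k) :
    tailPerm k τ (Fin.castAdd m i) = Fin.castAdd m i := by
  simp [tailPerm, Equiv.permCongr_apply]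

theorem tailPerm_natAdd {k m : ℕ} (τ : Equiv.Perm (Fin m)) (i : Fin m) :
    tailPerm k τ (Fin.natAdd k i) = Fin.natAdd k (τ i) := by
  simp [tailPerm, Equiv.permCongr_apply]

/-- Rearrangement of the last `m` entries of a signed permutation. -/
def SignedPerm.rearrange {k m : ℕ} (τ : Equiv.Perm (Fin m)) (π : SignedPerm (k + m)) :
    SignedPerm (k + m) :=
  ((tailPerm k τ).trans π.1, π.2 ∘ tailPerm k τ)

theorem rearrange_bijective {k m : ℕ} (τ : Equiv.Perm (Fin m)) :
    Function.Bijective (SignedPerm.rearrange (k := k) τ) := by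
  rw [← Finite.injective_iff_bijective]
  rintro ⟨σ, ε⟩ ⟨σ', ε'⟩ h
  simp only [SignedPerm.rearrange, Prod.mk.injEq] at h
  refine Prod.ext ?_ ((tailPerm k τ).surjective.injective_comp_right h.2)
  ext i
  have := congrArg (fun ρ : Equiv.Perm (Fin (k + m)) => ρ ((tailPerm k τ).symm i)) h.1
  exact congrArg Fin.val (by simpa using this)

theorem entry_rearrange {k m : ℕ} (τ : Equiv.Perm (Fin m)) (π : SignedPerm (k + m)) :
    (π.rearrange τ).entry = π.entry ∘ tailPerm k τ := rfl

/-- The last `m` entries. -/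
def SignedPerm.tail (k : ℕ) {m : ℕ} (π : SignedPerm (k + m)) (i : Fin m) : ℤ :=
  π.entry (Fin.natAdd k i)

theorem tail_injective (k : ℕ) {m : ℕ} (π : SignedPerm (k + m)) :
    Function.Injective (π.tail k) :=
  π.entry_injective.comp (Fin.natAdd_injective m k)

theorem tail_rearrange {k m : ℕ} (τ : Equiv.Perm (Fin m)) (π : SignedPerm (k + m)) :
    (π.rearrange τ).tail k = π.tail k ∘ τ := by
  ext i
  simp [SignedPerm.tail, entry_rearrange, tailPerm_natAdd]

/-- Ordinary inversions of a word. -/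
def wordInvA {α : Type*} [LinearOrder α] {m : ℕ} (w : Fin m → α) : ℕ :=
  ∑ j, ∑ i, if i < j then (if w j < w i then 1 else 0) else 0

/-- Type D inversions other than the ordinary inversions among the last `m` letters. -/
def restInv (k : ℕ) {m : ℕ} (e : Fin (k + m) → ℤ) : ℕ :=
  wordInv (fun i : Fin k => e (Fin.castAdd m i)) +
    (∑ j : Fin m, ∑ i : Fin k, ((if e (Fin.natAdd k j) < e (Fin.castAdd m i) then 1 else 0) +
      (if e (Fin.natAdd k j) < -e (Fin.castAdd m i) then 1 else 0)) +
    ∑ j : Fin m, ∑ i : Fin m, if i < j then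
      (if e (Fin.natAdd k j) < -e (Fin.natAdd k i) then 1 else 0) else 0)

theorem wordInv_eq_add_restInv (k : ℕ) {m : ℕ} (e : Fin (k + m) → ℤ) :
    wordInv e = wordInvA (fun i => e (Fin.natAdd k i)) + restInv k e := by
  have h1 : ∀ (i : Fin k) (j : Fin m), Fin.castAdd m i < Fin.natAdd k j := fun i j => by
    rw [Fin.lt_def]
    simp
    omega
  have h2 : ∀ (i : Fin k) (j : Fin m), ¬ Fin.natAdd k j < Fin.castAdd m i := fun i j =>
    (h1 i j).not_gt
  have h3 : ∀ i j : Fin m, Fin.natAdd k i < Fin.natAdd k j ↔ i < j := fun i j => by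
    rw [Fin.lt_def, Fin.lt_def]
    simp
  have h4 : ∀ i j : Fin k, Fin.castAdd m i < Fin.castAdd m j ↔ i < j := fun i j => Iff.rfl
  unfold wordInv restInv wordInvA
  simp only [Fin.sum_univ_add, h1, h2, h3, h4, if_true, if_false, sum_const_zero,
    sum_add_distrib]
  have h5 : ∀ i j : Fin m, (if i < j then
      ((if e (Fin.natAdd k j) < e (Fin.natAdd k i) then 1 else 0) +
      (if e (Fin.natAdd k j) < -e (Fin.natAdd k i) then 1 else 0)) else 0) =
      (if i < j then (if e (Fin.natAdd k j) < e (Fin.natAdd k i) then 1 else 0) else 0) +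
      (if i < j then (if e (Fin.natAdd k j) < -e (Fin.natAdd k i) then 1 else 0) else 0) := by
    intro i j
    split_ifs <;> rfl
  simp only [h5, sum_add_distrib, wordInv]
  ring

/-- For symmetric `g` the sum runs over unordered pairs, which a permutation only relabels; doubling
makes this a sum over all ordered pairs `i ≠ j`. -/
theorem sum_lt_comp_perm {m : ℕ} (g : Fin m → Fin m → ℕ) (hg : ∀ i j, g i j = g j i)
    (τ : Equiv.Perm (Fin m)) :
    (∑ j, ∑ i, if i < j then g (τ i) (τ j) else 0) = ∑ j, ∑ i, if i < j then g i j else 0 := by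
  have key : ∀ f : Fin m → Fin m → ℕ, (∀ i j, f i j = f j i) →
      2 * (∑ j, ∑ i, if i < j then f i j else 0) = ∑ j, ∑ i, if i ≠ j then f i j else 0 := by
    intro f hf
    rw [two_mul]
    nth_rewrite 2 [sum_comm]
    rw [← sum_add_distrib]
    refine sum_congr rfl fun j _ => ?_
    rw [← sum_add_distrib]
    refine sum_congr rfl fun i _ => ?_
    rcases lt_trichotomy i j with h | h | h
    · simp [h, h.ne, h.not_gt]
    · simp [h]
    · simp [h, h.ne', h.not_gt, hf]
  have h1 := key g hg
  have h2 := key (fun i j => g (τ i) (τ j)) fun i j => hg _ _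
  have h3 : (∑ j, ∑ i, if i ≠ j then g (τ i) (τ j) else 0) = ∑ j, ∑ i, if i ≠ j then g i j else 0 := by
    rw [← Equiv.sum_comp τ fun j => ∑ i, if i ≠ j then g i j else 0]
    refine sum_congr rfl fun j _ => ?_
    rw [← Equiv.sum_comp τ fun i => if i ≠ τ j then g i (τ j) else 0]
    refine sum_congr rfl fun i _ => ?_
    simp
  omega

/-- Inside the tail only the condition `e_i + e_j < 0` is left, which is symmetric in the two
positions. -/
theorem restInv_rearrange {k m : ℕ} (τ : Equiv.Perm (Fin m)) (π : SignedPerm (k + m)) :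
    restInv k (π.rearrange τ).entry = restInv k π.entry := by
  unfold restInv
  simp only [entry_rearrange, Function.comp, tailPerm_castAdd, tailPerm_natAdd]
  congr 2
  · exact Equiv.sum_comp τ fun j => ∑ i : Fin k,
      ((if π.entry (Fin.natAdd k j) < π.entry (Fin.castAdd m i) then 1 else 0) +
      (if π.entry (Fin.natAdd k j) < -π.entry (Fin.castAdd m i) then 1 else 0))
  · refine sum_lt_comp_perm (fun i j =>
      if π.entry (Fin.natAdd k j) < -π.entry (Fin.natAdd k i) then 1 else 0) (fun i j => ?_) τ
    congr 1
    exact propext lt_neg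

/-- Composing with the sorting permutation reindexes the sum over all rearrangements, so only
increasing words need checking. -/
theorem sum_perm_of_strictMono {K M : Type*} [AddCommMonoid M] [LinearOrder K] {m : ℕ}
    (g : (Fin m → K) → M) (c : M)
    (h : ∀ w : Fin m → K, StrictMono w → ∑ τ : Equiv.Perm (Fin m), g (w ∘ τ) = c)
    (w : Fin m → K) (hw : Function.Injective w) :
    ∑ τ : Equiv.Perm (Fin m), g (w ∘ τ) = c := by
  rw [← h (w ∘ Tuple.sort w)
    ((Tuple.monotone_sort w).strictMono_of_injective (hw.comp (Tuple.sort w).injective)),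
    ← Equiv.sum_comp (Equiv.mulLeft (Tuple.sort w))]
  rfl

theorem wordInvA_insertLast {n : ℕ} (p : Fin (n + 1)) (σ : Equiv.Perm (Fin n)) :
    wordInvA (insertLast p σ) = wordInvA σ + (n - p) := by
  unfold wordInvA
  rw [Fin.sum_univ_castSucc]
  congr 1
  · refine sum_congr rfl fun j _ => ?_
    rw [Fin.sum_univ_castSucc, if_neg (by exact not_lt.2 (Fin.le_last _)), add_zero]
    simp only [insertLast_castSucc, Fin.castSucc_lt_castSucc_iff, Fin.succAbove_lt_succAbove_iff]
  · rw [Fin.sum_univ_castSucc]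
    simp only [Fin.castSucc_lt_last, if_true, lt_self_iff_false, if_false, add_zero,
      insertLast_castSucc, insertLast_last]
    rw [← sum_le_castSucc p]
    exact Equiv.sum_comp σ fun a => if p < p.succAbove a then 1 else 0

section Field

variable {K : Type*} [Field K]

theorem sum_pow_wordInvA (q : K) (m : ℕ) :
    ∑ τ : Equiv.Perm (Fin m), q ^ wordInvA τ = qFact q m := by
  induction m with
  | zero => simp [wordInvA, qFact]
  | succ n ih =>
    rw [← Function.Bijective.sum_comp (insertLast_bijective n), Fintype.sum_prod_type]
    simp only [wordInvA_insertLast, pow_add, ← sum_mul, ih, ← mul_sum, sum_pow_rev]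
    rw [qFact, qFact, prod_Icc_succ_top (by omega)]

theorem sum_pow_wordInvA_comp (q : K) {m : ℕ} (w : Fin m → ℤ) (hw : Function.Injective w) :
    ∑ τ : Equiv.Perm (Fin m), q ^ wordInvA (w ∘ τ) = qFact q m := by
  refine sum_perm_of_strictMono (fun w => q ^ wordInvA w) _ (fun w hw => ?_) w hw
  rw [← sum_pow_wordInvA]
  simp only [wordInvA, Function.comp, hw.lt_iff_lt]

open Classical in
theorem sum_strictMono_comp {m : ℕ} (w : Fin m → ℤ) (hw : Function.Injective w) :
    ∑ τ : Equiv.Perm (Fin m), (if StrictMono (w ∘ τ) then (1 : K) else 0) = 1 := by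
  refine sum_perm_of_strictMono (fun w => if StrictMono w then (1 : K) else 0) _
    (fun w hw => ?_) w hw
  rw [sum_eq_single 1]
  · exact if_pos hw
  · intro τ _ hτ
    refine if_neg fun h => hτ ?_
    have h' : StrictMono τ := fun i j hij => hw.lt_iff_lt.1 (h hij)
    refine Equiv.ext fun i => ?_
    exact h'.apply_eq
  · simp

/-- Averaging over the `m!` rearrangements of the tail: `R` is constant on orbits, while `h` sums to
the same `c` on each. Applied with `q^inv` and with the indicator of an increasing word, it compares
the two sums. -/
theorem factorial_mul_sum_tail {k m : ℕ} (R : SignedPerm (k + m) → K)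
    (hR : ∀ τ π, R (SignedPerm.rearrange τ π) = R π) (h : (Fin m → ℤ) → K) (c : K)
    (hc : ∀ w, Function.Injective w → ∑ τ : Equiv.Perm (Fin m), h (w ∘ τ) = c) :
    (m.factorial : K) * ∑ π, R π * h (π.tail k) = c * ∑ π, R π := by
  calc (m.factorial : K) * ∑ π, R π * h (π.tail k)
      = ∑ τ : Equiv.Perm (Fin m), ∑ π : SignedPerm (k + m), R π * h (π.tail k) := by
        simp [Fintype.card_perm]
    _ = ∑ τ : Equiv.Perm (Fin m), ∑ π, R π * h (π.tail k ∘ τ) := by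
        refine sum_congr rfl fun τ _ => ?_
        rw [← Function.Bijective.sum_comp (rearrange_bijective τ)]
        simp only [hR, tail_rearrange]
    _ = c * ∑ π, R π := by
        rw [sum_comm, mul_sum]
        refine sum_congr rfl fun π _ => ?_
        rw [← mul_sum, hc _ (tail_injective k π), mul_comm]

theorem wordInvA_eq_zero {m : ℕ} {w : Fin m → ℤ} (hw : StrictMono w) : wordInvA w = 0 := by
  unfold wordInvA
  refine sum_eq_zero fun j _ => sum_eq_zero fun i _ => ?_
  split_ifs with h h'
  · exact absurd h' (hw h).not_gt
  all_goals rfl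

open Classical in
/-- Sorting the last `m` entries. -/
theorem sum_pow_inv_eq_qFact_mul [CharZero K] (q : K) {k m : ℕ} (F : SignedPerm (k + m) → K)
    (hF : ∀ τ π, F (SignedPerm.rearrange τ π) = F π) :
    ∑ π, F π * q ^ π.inv =
      qFact q m * ∑ π, F π * (if StrictMono (π.tail k) then 1 else 0) * q ^ π.inv := by
  have hR : ∀ τ π, F (SignedPerm.rearrange τ π) *
      q ^ restInv k (SignedPerm.rearrange τ π).entry = F π * q ^ restInv k π.entry := by
    intro τ π
    rw [hF, restInv_rearrange]
  have h1 := factorial_mul_sum_tail (fun π => F π * q ^ restInv k π.entry) hR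
    (fun w => q ^ wordInvA w) _ (sum_pow_wordInvA_comp q)
  have h2 := factorial_mul_sum_tail (fun π => F π * q ^ restInv k π.entry) hR
    (fun w => if StrictMono w then (1 : K) else 0) _ sum_strictMono_comp
  have h3 : ∀ π : SignedPerm (k + m), F π * q ^ π.inv =
      F π * q ^ restInv k π.entry * q ^ wordInvA (π.tail k) := by
    intro π
    rw [inv_eq_wordInv, wordInv_eq_add_restInv k, add_comm, pow_add, mul_assoc]
    rfl
  have h4 : ∀ π : SignedPerm (k + m),
      F π * (if StrictMono (π.tail k) then 1 else 0) * q ^ π.inv =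
      F π * q ^ restInv k π.entry * (if StrictMono (π.tail k) then 1 else 0) := by
    intro π
    rw [mul_right_comm, h3]
    split_ifs with h
    · rw [wordInvA_eq_zero h, pow_zero, mul_one]
    · simp
  rw [sum_congr rfl fun π _ => h3 π, sum_congr rfl fun π _ => h4 π]
  -- Characteristic zero allows the averaging factor `m!` to be cancelled.
  have hm : (m.factorial : K) ≠ 0 := by exact_mod_cast m.factorial_ne_zero
  refine mul_left_cancel₀ hm ?_
  rw [h1, mul_left_comm, h2, one_mul]

/-! ### Ascent indicators and prefix weights -/

/-- Indicator of an ascent at a positive index. -/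
noncomputable def ascInd (K : Type*) [Field K] {n : ℕ} (π : SignedPerm n) (i : ℕ) : K :=
  if π.val (i : ℤ) < π.val ((i + 1 : ℕ) : ℤ) then 1 else 0

/-- Indicator of an ascent at the index `-1`. -/
noncomputable def ascIndNeg (K : Type*) [Field K] {n : ℕ} (π : SignedPerm n) : K :=
  if -π.val 1 < π.val 2 then 1 else 0

/-- The weight of the indices below `k`, where an ascent at `i` has weight `t i + c i` and a
descent has weight `t i`. -/
noncomputable def prefixWeight (t c : ℕ → K) (k : ℕ) {n : ℕ} (π : SignedPerm n) : K :=
  (t 1 + c 1 * ascIndNeg K π) * ∏ i ∈ Ico 1 k, (t i + c i * ascInd K π i)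

theorem val_one {n : ℕ} (π : SignedPerm n) (h : 0 < n) : π.val 1 = π.entry ⟨0, h⟩ :=
  π.val_succ ⟨0, h⟩

theorem val_two {n : ℕ} (π : SignedPerm n) (h : 1 < n) : π.val 2 = π.entry ⟨1, h⟩ :=
  π.val_succ ⟨1, h⟩

theorem val_succ' {n : ℕ} (π : SignedPerm n) {i : ℕ} (h : i < n) :
    π.val ((i + 1 : ℕ) : ℤ) = π.entry ⟨i, h⟩ := by
  rw [← val_succ]
  simp

theorem ascInd_insertLast {n : ℕ} (p : Fin (n + 1)) (ε : ℤˣ) (σ : SignedPerm n) {i : ℕ}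
    (h1 : 1 ≤ i) (h2 : i < n) : ascInd K (SignedPerm.insertLast p ε σ) i = ascInd K σ i := by
  obtain ⟨i, rfl⟩ := Nat.exists_eq_add_of_le' h1
  unfold ascInd
  rw [val_succ' _ (by omega), val_succ' _ (by omega), val_succ' _ (by omega), val_succ' _ (by omega)]
  exact if_congr (entry_insertLast_lt p ε σ ⟨i, by omega⟩ ⟨i + 1, by omega⟩) rfl rfl

theorem ascIndNeg_insertLast {n : ℕ} (p : Fin (n + 1)) (ε : ℤˣ) (σ : SignedPerm n) (h : 2 ≤ n) :
    ascIndNeg K (SignedPerm.insertLast p ε σ) = ascIndNeg K σ := by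
  unfold ascIndNeg
  rw [val_one _ (by omega), val_two _ (by omega), val_one _ (by omega), val_two _ (by omega)]
  refine if_congr ?_ rfl rfl
  have h1 := entry_insertLast_lt_neg p ε σ ⟨1, by omega⟩ ⟨0, by omega⟩
  have h3 := (SignedPerm.insertLast p ε σ).entry_ne_of_ne
    (i := ⟨0, by omega⟩) (j := ⟨1, by omega⟩) (by simp)
  have h4 := σ.entry_ne_of_ne (i := ⟨0, by omega⟩) (j := ⟨1, by omega⟩) (by simp)
  simp only [Fin.castSucc_mk] at h1
  omega

theorem prefixWeight_insertLast (t c : ℕ → K) {k n : ℕ} (h : 2 ≤ n) (hk : k ≤ n)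
    (p : Fin (n + 1)) (ε : ℤˣ) (σ : SignedPerm n) :
    prefixWeight t c k (SignedPerm.insertLast p ε σ) = prefixWeight t c k σ := by
  unfold prefixWeight
  rw [ascIndNeg_insertLast p ε σ h]
  congr 1
  refine prod_congr rfl fun i hi => ?_
  rw [mem_Ico] at hi
  rw [ascInd_insertLast p ε σ (by omega) (by omega)]

theorem ascInd_rearrange {k m : ℕ} (τ : Equiv.Perm (Fin m)) (π : SignedPerm (k + m)) {i : ℕ}
    (h1 : 1 ≤ i) (h2 : i < k) : ascInd K (π.rearrange τ) i = ascInd K π i := by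
  obtain ⟨i, rfl⟩ := Nat.exists_eq_add_of_le' h1
  unfold ascInd
  rw [val_succ' _ (by omega), val_succ' _ (by omega), val_succ' _ (by omega), val_succ' _ (by omega),
    entry_rearrange]
  have h3 := tailPerm_castAdd (k := k) τ ⟨i, by omega⟩
  have h4 := tailPerm_castAdd (k := k) τ ⟨i + 1, h2⟩
  simp only [Fin.castAdd_mk] at h3 h4
  simp only [Function.comp, h3, h4]

theorem ascIndNeg_rearrange {k m : ℕ} (τ : Equiv.Perm (Fin m)) (π : SignedPerm (k + m))
    (h : 2 ≤ k) : ascIndNeg K (π.rearrange τ) = ascIndNeg K π := by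
  unfold ascIndNeg
  rw [val_one _ (by omega), val_two _ (by omega), val_one _ (by omega), val_two _ (by omega),
    entry_rearrange]
  have h3 := tailPerm_castAdd (k := k) τ ⟨0, by omega⟩
  have h4 := tailPerm_castAdd (k := k) τ ⟨1, by omega⟩
  simp only [Fin.castAdd_mk] at h3 h4
  simp only [Function.comp, h3, h4]

theorem prefixWeight_rearrange (t c : ℕ → K) {k m : ℕ} (h : 2 ≤ k)
    (τ : Equiv.Perm (Fin m)) (π : SignedPerm (k + m)) :
    prefixWeight t c k (π.rearrange τ) = prefixWeight t c k π := by
  unfold prefixWeight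
  rw [ascIndNeg_rearrange τ π h]
  congr 1
  refine prod_congr rfl fun i hi => ?_
  rw [mem_Ico] at hi
  rw [ascInd_rearrange τ π (by omega) (by omega)]

/-- The range starts at `k + 1` because index `k` compares the last prefix entry with the first tail
entry and stays unconstrained at a cut. -/
theorem strictMono_tail_iff {k m : ℕ} (π : SignedPerm (k + m)) :
    StrictMono (π.tail k) ↔
      ∀ i ∈ Ico (k + 1) (k + m), π.val (i : ℤ) < π.val ((i + 1 : ℕ) : ℤ) := by
  have ht : ∀ (j : ℕ) (hj : j < m), π.val ((k + j + 1 : ℕ) : ℤ) = π.tail k ⟨j, hj⟩ :=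
    fun j hj => val_succ' π (by omega)
  rcases m with _ | m
  · simp [Subsingleton.strictMono]
  rw [Fin.strictMono_iff_lt_succ]
  constructor
  · intro h i hi
    rw [mem_Ico] at hi
    obtain ⟨j, rfl⟩ := Nat.exists_eq_add_of_le hi.1
    have := h ⟨j, by omega⟩
    simp only [Fin.castSucc_mk, Fin.succ_mk, ← ht] at this
    rwa [show k + 1 + j = k + j + 1 by ring, show k + j + 1 + 1 = k + (j + 1) + 1 by ring]
  · intro h j
    have := h (k + j + 1) (by rw [mem_Ico]; omega)
    rw [ht j (by omega), show k + (j : ℕ) + 1 + 1 = k + (j + 1) + 1 by ring, ht _ (by omega)] at this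
    exact this

open Classical in
theorem prod_ascInd {k m : ℕ} (π : SignedPerm (k + m)) :
    ∏ i ∈ Ico (k + 1) (k + m), ascInd K π i = if StrictMono (π.tail k) then 1 else 0 := by
  unfold ascInd
  rw [prod_ite_zero]
  simp only [prod_const_one]
  exact if_congr (strictMono_tail_iff π).symm rfl rfl

theorem sum_pow_inv_sort [CharZero K] (q : K) {k m : ℕ} (F : SignedPerm (k + m) → K)
    (hF : ∀ τ π, F (SignedPerm.rearrange τ π) = F π) :
    ∑ π, F π * q ^ π.inv =
      qFact q m * ∑ π, F π * (∏ i ∈ Ico (k + 1) (k + m), ascInd K π i) * q ^ π.inv := by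
  classical
  simp only [prod_ascInd]
  exact sum_pow_inv_eq_qFact_mul q F hF

theorem sum_prefixWeight (q : K) (t c : ℕ → K) {k : ℕ} (h : 2 ≤ k) (m : ℕ) :
    ∑ π : SignedPerm (k + m), prefixWeight t c k π * q ^ π.inv =
      (∏ i ∈ Ico k (k + m), qInt q (i + 1) * (1 + q ^ i)) *
        ∑ π : SignedPerm k, prefixWeight t c k π * q ^ π.inv := by
  induction m with
  | zero => simp
  | succ m ih =>
    have := sum_pow_inv_succ (n := k + m) q (prefixWeight t c k) (prefixWeight t c k)
      (prefixWeight_insertLast t c (by omega) (by omega))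
    rw [show k + (m + 1) = k + m + 1 from rfl, this, ih, prod_Ico_succ_top (by omega)]
    ring

theorem sum_pow_inv (q : K) (n : ℕ) :
    ∑ π : SignedPerm n, q ^ π.inv = ∏ i ∈ range n, qInt q (i + 1) * (1 + q ^ i) := by
  induction n with
  | zero =>
    simp [inv_eq_wordInv, wordInv]
  | succ n ih =>
    have := sum_pow_inv_succ (n := n) q (fun _ => 1) (fun _ => 1) (fun _ _ _ => rfl)
    simp only [one_mul] at this
    rw [this, ih, prod_range_succ]
    ring

/-! ### Words with no cut after the first position -/

/-- Negating the first entry. -/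
def SignedPerm.negFirst {n : ℕ} (π : SignedPerm (n + 1)) : SignedPerm (n + 1) :=
  (π.1, Function.update π.2 0 (-π.2 0))

theorem negFirst_involutive {n : ℕ} :
    Function.Involutive (SignedPerm.negFirst (n := n)) := by
  intro π
  simp [SignedPerm.negFirst]

theorem entry_negFirst_zero {n : ℕ} (π : SignedPerm (n + 1)) :
    π.negFirst.entry 0 = -π.entry 0 := by
  simp [entry, SignedPerm.negFirst]

theorem entry_negFirst_of_ne {n : ℕ} (π : SignedPerm (n + 1)) {i : Fin (n + 1)} (h : i ≠ 0) :
    π.negFirst.entry i = π.entry i := by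
  simp [entry, SignedPerm.negFirst, h]

theorem inv_negFirst {n : ℕ} (π : SignedPerm (n + 1)) : π.negFirst.inv = π.inv := by
  rw [inv_eq_wordInv, inv_eq_wordInv]
  unfold wordInv
  refine sum_congr rfl fun j _ => sum_congr rfl fun i _ => ?_
  by_cases h : i < j
  · rw [if_pos h, if_pos h, entry_negFirst_of_ne π (Fin.ne_zero_of_lt h)]
    by_cases hi : i = 0
    · rw [hi, entry_negFirst_zero, neg_neg, add_comm]
    · rw [entry_negFirst_of_ne π hi]
  · rw [if_neg h, if_neg h]

theorem ascInd_negFirst {n : ℕ} (π : SignedPerm (n + 1)) {i : ℕ} (h1 : 2 ≤ i) (h2 : i ≤ n) :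
    ascInd K π.negFirst i = ascInd K π i := by
  obtain ⟨i, rfl⟩ := Nat.exists_eq_add_of_le' h1
  unfold ascInd
  rw [show i + 2 = i + 1 + 1 from rfl, val_succ' _ (by omega), val_succ' _ (by omega),
    val_succ' _ (by omega), val_succ' _ (by omega), entry_negFirst_of_ne, entry_negFirst_of_ne] <;>
  simp [Fin.ext_iff]

theorem ascIndNeg_negFirst {n : ℕ} (π : SignedPerm (n + 2)) :
    ascIndNeg K π.negFirst = ascInd K π 1 := by
  unfold ascIndNeg ascInd
  rw [show ((1 + 1 : ℕ) : ℤ) = 2 from rfl, Nat.cast_one, val_one _ (by omega), val_two _ (by omega),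
    val_one _ (by omega), val_two _ (by omega),
    entry_negFirst_of_ne π (i := ⟨1, by omega⟩) (by simp)]
  have := entry_negFirst_zero π
  simp only [Fin.zero_eta, this, neg_neg]
  rfl

/-- Negating the first entry exchanges the indices `-1` and `1` and preserves `inv_D`, so the two
mixed terms agree. -/
theorem sum_ascIndNeg {n : ℕ} (q : K) :
    ∑ π : SignedPerm (n + 2), ascIndNeg K π * (∏ i ∈ Ico 2 (n + 2), ascInd K π i) * q ^ π.inv =
      ∑ π : SignedPerm (n + 2), (∏ i ∈ Ico 1 (n + 2), ascInd K π i) * q ^ π.inv := by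
  rw [← Equiv.sum_comp (negFirst_involutive (n := n + 1)).toPerm]
  refine sum_congr rfl fun π _ => ?_
  simp only [Function.Involutive.coe_toPerm, inv_negFirst, ascIndNeg_negFirst]
  rw [prod_eq_prod_Ico_succ_bot (by omega : 1 < n + 2)]
  congr 2
  refine prod_congr rfl fun i hi => ?_
  rw [mem_Ico] at hi
  rw [ascInd_negFirst π (by omega) (by omega)]

/-- Ascents at both `-1` and `1` mean `|π₁| < π₂`. With the remaining ascents, the absolute values
increase and every entry but the first is positive. -/
theorem strictMono_entry_and_iff {n : ℕ} (π : SignedPerm (n + 2)) :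
    (-π.entry 0 < π.entry 1 ∧ StrictMono π.entry) ↔ π.1 = 1 ∧ ∀ i, i ≠ 0 → π.2 i = 1 := by
  constructor
  · rintro ⟨h0, h⟩
    have h01 : π.entry 0 < π.entry 1 := h (by simp)
    have h1 : ∀ i, i ≠ 0 → π.entry 1 ≤ π.entry i := fun i hi =>
      h.monotone (Fin.one_le_of_ne_zero hi)
    have h2 : ∀ i, i ≠ 0 → π.2 i = 1 := by
      intro i hi
      rcases Int.units_eq_one_or (π.2 i) with h' | h'
      · exact h'
      · have := h1 i hi
        have h3 : π.entry i = -((π.1 i : ℕ) + 1) := by simp [entry, h']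
        omega
    refine ⟨?_, h2⟩
    have hm : StrictMono π.1 := by
      intro i j hij
      have hj : j ≠ 0 := Fin.ne_zero_of_lt hij
      have h3 := π.natAbs_entry i
      have h4 := π.natAbs_entry j
      have h5 := h hij
      have h6 := h1 j hj
      rw [Fin.lt_def]
      by_cases hi : i = 0
      · subst hi
        omega
      · have h7 := h1 i hi
        omega
    exact Equiv.ext fun i => hm.apply_eq
  · rintro ⟨h1, h2⟩
    have h3 : ∀ i, i ≠ 0 → π.entry i = (i : ℕ) + 1 := by
      intro i hi
      simp [entry, h1, h2 i hi]
    have h4 : (π.entry 0).natAbs = 1 := by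
      rw [natAbs_entry, h1]
      simp
    refine ⟨?_, fun i j hij => ?_⟩
    · rw [h3 1 (by simp)]
      simp only [Fin.val_one]
      omega
    · have hj : j ≠ 0 := Fin.ne_zero_of_lt hij
      rw [h3 j hj]
      rw [Fin.lt_def] at hij
      by_cases hi : i = 0
      · subst hi
        simp at hij
        omega
      · rw [h3 i hi]
        omega

theorem inv_eq_zero_of_strictMono {n : ℕ} (π : SignedPerm (n + 2))
    (h : π.1 = 1 ∧ ∀ i, i ≠ 0 → π.2 i = 1) : π.inv = 0 := by
  have h3 : ∀ i, i ≠ 0 → π.entry i = (i : ℕ) + 1 := by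
    intro i hi
    simp [entry, h.1, h.2 i hi]
  have h4 : ∀ i, (π.entry i).natAbs = i + 1 := by
    intro i
    rw [natAbs_entry, h.1]
    simp
  rw [inv_eq_wordInv]
  unfold wordInv
  refine sum_eq_zero fun j _ => sum_eq_zero fun i _ => ?_
  split_ifs with h5 h6 h7 h7
  all_goals try rfl
  all_goals
    have := h3 j (Fin.ne_zero_of_lt h5)
    have := h4 i
    rw [Fin.lt_def] at h5
    omega

/-- Only the identity and its variant with negated first entry survive, and both have length zero.
-/
theorem sum_ascIndNeg_mul_prod (n : ℕ) (q : K) :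
    ∑ π : SignedPerm (n + 2), ascIndNeg K π * (∏ i ∈ Ico 1 (n + 2), ascInd K π i) * q ^ π.inv =
      2 := by
  classical
  have h1 : ∀ π : SignedPerm (n + 2),
      ascIndNeg K π * (∏ i ∈ Ico 1 (n + 2), ascInd K π i) * q ^ π.inv =
      if π.1 = 1 ∧ ∀ i, i ≠ 0 → π.2 i = 1 then 1 else 0 := by
    intro π
    have h2 : (∏ i ∈ Ico 1 (n + 2), ascInd K π i) = if StrictMono π.entry then 1 else 0 := by
      unfold ascInd
      rw [prod_ite_zero]
      simp only [prod_const_one]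
      refine if_congr ?_ rfl rfl
      rw [Fin.strictMono_iff_lt_succ]
      constructor
      · intro h i
        have := h (i + 1) (by rw [mem_Ico]; omega)
        rwa [val_succ' _ (by omega), val_succ' _ (by omega)] at this
      · intro h i hi
        rw [mem_Ico] at hi
        obtain ⟨i, rfl⟩ := Nat.exists_eq_add_of_le' hi.1
        rw [val_succ' _ (by omega), val_succ' _ (by omega)]
        exact h ⟨i, by omega⟩
    rw [h2]
    unfold ascIndNeg
    rw [val_one _ (by omega), val_two _ (by omega), ite_zero_mul_ite_zero, one_mul]
    split_ifs with h h' h'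
    · rw [inv_eq_zero_of_strictMono π h', pow_zero, mul_one]
    · exact absurd ((strictMono_entry_and_iff π).1 h) h'
    · exact absurd ((strictMono_entry_and_iff π).2 h') h
    · simp
  rw [sum_congr rfl fun π _ => h1 π, sum_boole]
  have h2 : (univ.filter fun π : SignedPerm (n + 2) => π.1 = 1 ∧ ∀ i, i ≠ 0 → π.2 i = 1) =
      {((1, 1) : SignedPerm (n + 2)), ((1, Function.update (fun _ => 1) 0 (-1)) : SignedPerm (n + 2))} := by
    ext ⟨σ, ε⟩
    simp only [mem_filter, mem_univ, true_and, mem_insert, mem_singleton, Prod.mk.injEq]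
    constructor
    · rintro ⟨rfl, h⟩
      rcases Int.units_eq_one_or (ε 0) with h0 | h0
      · left
        refine ⟨rfl, funext fun i => ?_⟩
        by_cases hi : i = 0
        · rw [hi, h0]
          rfl
        · rw [h i hi]
          rfl
      · right
        refine ⟨rfl, funext fun i => ?_⟩
        by_cases hi : i = 0
        · rw [hi, h0]
          simp
        · rw [h i hi]
          simp [hi]
    · rintro (⟨rfl, rfl⟩ | ⟨rfl, rfl⟩)
      · simp
      · simp +contextual
  rw [h2, card_pair]
  · norm_num
  · intro h
    have := congrFun (Prod.mk.inj h).2 0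
    simp at this

end Field

/-! ### From all signed permutations to `𝔇_n` -/

/-- Negating the entry of absolute value `1`. -/
def SignedPerm.negOne {n : ℕ} (π : SignedPerm (n + 1)) : SignedPerm (n + 1) :=
  (π.1, Function.update π.2 (π.1.symm 0) (-π.2 (π.1.symm 0)))

theorem negOne_involutive {n : ℕ} : Function.Involutive (SignedPerm.negOne (n := n)) := by
  intro π
  simp [SignedPerm.negOne]

theorem entry_negOne {n : ℕ} (π : SignedPerm (n + 1)) (i : Fin (n + 1)) :
    (π.negOne.entry i = -π.entry i ∧ (π.entry i).natAbs = 1 ∧ i = π.1.symm 0) ∨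
      (π.negOne.entry i = π.entry i ∧ 2 ≤ (π.entry i).natAbs ∧ i ≠ π.1.symm 0) := by
  by_cases h : i = π.1.symm 0
  · left
    refine ⟨?_, ?_, h⟩
    · simp [entry, SignedPerm.negOne, h]
    · rw [natAbs_entry, h]
      simp
  · right
    refine ⟨?_, ?_, h⟩
    · simp [entry, SignedPerm.negOne, h]
    · rw [natAbs_entry]
      have : π.1 i ≠ 0 := fun h' => h (by rw [← h']; simp)
      have : (π.1 i : ℕ) ≠ 0 := fun h' => this (Fin.ext h')
      omega

/-- Every comparison is between numbers of distinct absolute values. If one of these is `1`, the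
sign of the other, larger one decides it. -/
theorem inv_negOne {n : ℕ} (π : SignedPerm (n + 1)) : π.negOne.inv = π.inv := by
  rw [inv_eq_wordInv, inv_eq_wordInv]
  unfold wordInv
  refine sum_congr rfl fun j _ => sum_congr rfl fun i _ => ?_
  by_cases h : i < j
  · rw [if_pos h, if_pos h]
    have h1 := π.entry_ne_of_ne h.ne
    rcases entry_negOne π i with ⟨hi, hi', -⟩ | ⟨hi, hi', -⟩ <;>
      rcases entry_negOne π j with ⟨hj, hj', -⟩ | ⟨hj, hj', -⟩ <;> rw [hi, hj] <;>
      split_ifs <;> omega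
  · rw [if_neg h, if_neg h]

theorem entry_negOne_lt {n : ℕ} (π : SignedPerm (n + 1)) {i j : Fin (n + 1)} (h : i ≠ j) :
    π.negOne.entry i < π.negOne.entry j ↔ π.entry i < π.entry j := by
  have h1 := π.entry_ne_of_ne h
  rcases entry_negOne π i with ⟨hi, hi', -⟩ | ⟨hi, hi', -⟩ <;>
    rcases entry_negOne π j with ⟨hj, hj', -⟩ | ⟨hj, hj', -⟩ <;> rw [hi, hj] <;> omega

theorem neg_entry_negOne_lt {n : ℕ} (π : SignedPerm (n + 1)) {i j : Fin (n + 1)} (h : i ≠ j) :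
    -π.negOne.entry i < π.negOne.entry j ↔ -π.entry i < π.entry j := by
  have h1 := π.entry_ne_of_ne h
  rcases entry_negOne π i with ⟨hi, hi', -⟩ | ⟨hi, hi', -⟩ <;>
    rcases entry_negOne π j with ⟨hj, hj', -⟩ | ⟨hj, hj', -⟩ <;> rw [hi, hj] <;> omega

theorem mem_group_iff {n : ℕ} (π : SignedPerm n) :
    π ∈ group n ↔ Even (∑ i, if π.entry i < 0 then 1 else 0) := by
  rw [group, mem_filter, card_filter, sum_Icc_one_int]
  simp only [mem_univ, true_and, val_succ]

theorem negOne_mem_group_iff {n : ℕ} (π : SignedPerm (n + 1)) :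
    π.negOne ∈ group (n + 1) ↔ π ∉ group (n + 1) := by
  rw [mem_group_iff, mem_group_iff, ← add_sum_erase univ _ (mem_univ (π.1.symm 0)),
    ← add_sum_erase univ (fun i => if π.entry i < 0 then 1 else 0) (mem_univ (π.1.symm 0))]
  have h1 : ∀ i ∈ univ.erase (π.1.symm 0), (if π.negOne.entry i < 0 then 1 else 0) =
      if π.entry i < 0 then 1 else 0 := by
    intro i hi
    rcases entry_negOne π i with ⟨-, -, h⟩ | ⟨h, -, -⟩
    · exact absurd h (ne_of_mem_erase hi)
    · rw [h]
  rw [sum_congr rfl h1]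
  rcases entry_negOne π (π.1.symm 0) with ⟨h, h', -⟩ | ⟨-, -, h⟩
  · rw [h, Nat.even_add, Nat.even_add]
    have h2 : π.entry (π.1.symm 0) = 1 ∨ π.entry (π.1.symm 0) = -1 := by omega
    rcases h2 with h2 | h2 <;> rw [h2] <;> norm_num
  · exact absurd rfl h

section Field

variable {K : Type*} [Field K]

theorem sum_eq_two_mul_sum_group {n : ℕ} (F : SignedPerm (n + 1) → K)
    (hF : ∀ π, F (SignedPerm.negOne π) = F π) : ∑ π, F π = 2 * ∑ π ∈ group (n + 1), F π := by
  classical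
  rw [← sum_filter_add_sum_filter_not univ (· ∈ group (n + 1)) F, two_mul]
  congr 1
  · simp
  · refine sum_nbij' SignedPerm.negOne SignedPerm.negOne ?_ ?_ ?_ ?_ ?_
    · intro π hπ
      rw [negOne_mem_group_iff]
      exact (mem_filter.1 hπ).2
    · intro π hπ
      simpa [negOne_mem_group_iff] using hπ
    · intro π _
      exact negOne_involutive π
    · intro π _
      exact negOne_involutive π
    · intro π _
      exact (hF π).symm

theorem ascInd_negOne {n : ℕ} (π : SignedPerm (n + 1)) {i : ℕ} (h1 : 1 ≤ i) (h2 : i ≤ n) :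
    ascInd K π.negOne i = ascInd K π i := by
  obtain ⟨i, rfl⟩ := Nat.exists_eq_add_of_le' h1
  unfold ascInd
  rw [val_succ' _ (by omega), val_succ' _ (by omega), val_succ' _ (by omega), val_succ' _ (by omega)]
  exact if_congr (entry_negOne_lt π (by simp)) rfl rfl

theorem ascIndNeg_negOne {n : ℕ} (π : SignedPerm (n + 2)) :
    ascIndNeg K π.negOne = ascIndNeg K π := by
  unfold ascIndNeg
  rw [val_one _ (by omega), val_two _ (by omega), val_one _ (by omega), val_two _ (by omega)]
  exact if_congr (neg_entry_negOne_lt π (by simp)) rfl rfl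

theorem prefixWeight_negOne (t c : ℕ → K) {n : ℕ} (π : SignedPerm (n + 2)) :
    prefixWeight t c (n + 2) π.negOne = prefixWeight t c (n + 2) π := by
  unfold prefixWeight
  rw [ascIndNeg_negOne]
  congr 1
  refine prod_congr rfl fun i hi => ?_
  rw [mem_Ico] at hi
  rw [ascInd_negOne π (by omega) (by omega)]

/-- The sequence equal to `a` at even and to `b` at odd indices. -/
def byParity (a b : K) (i : ℕ) : K := if Even i then a else b

theorem prod_indices {M : Type*} [CommMonoid M] (n : ℕ) (f : ℤ → M) :
    ∏ i ∈ indices (n + 2), f i = f (-1) * ∏ i ∈ Ico 1 (n + 2), f (i : ℕ) := by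
  have h : indices (n + 2) = insert (-1) ((Ico 1 (n + 2)).image fun i : ℕ => (i : ℤ)) := by
    ext i
    simp only [indices, mem_filter, mem_Icc, mem_insert, mem_image, mem_Ico]
    constructor
    · rintro ⟨⟨h1, h2⟩, h3, h4⟩
      by_cases h : i = -1
      · exact Or.inl h
      · exact Or.inr ⟨i.toNat, by omega, by omega⟩
    · rintro (rfl | ⟨j, hj, rfl⟩)
      · simp
        omega
      · rw [abs_of_nonneg (by omega)]
        push_cast
        omega
  rw [h, prod_insert, prod_image]
  · intro a _ b _ hab
    exact Nat.cast_injective hab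
  · simp only [mem_image, mem_Ico, not_exists, not_and]
    intro j _
    omega

theorem val_ne_of_mem_indices {n : ℕ} (π : SignedPerm n) {i : ℤ} (hi : i ∈ indices n) :
    π.val i ≠ π.val (|i| + 1) := by
  simp only [indices, mem_filter, mem_Icc] at hi
  obtain ⟨j, hj⟩ := Nat.exists_eq_add_of_le' (show 1 ≤ i.natAbs by omega)
  have habs : |i| = ((j + 1 : ℕ) : ℤ) := by rw [Int.abs_eq_natAbs, hj]
  have hlt : j + 1 < n := by omega
  rw [habs]
  have h1 := val_succ' π (show j < n by omega)
  have h2 := val_succ' π hlt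
  push_cast at h1 h2 ⊢
  have h3 := π.entry_ne_of_ne (i := ⟨j, by omega⟩) (j := ⟨j + 1, hlt⟩) (by simp)
  rcases Int.natAbs_eq i with h | h
  · rw [h, hj]
    push_cast
    rw [h1, h2]
    intro h
    rw [h] at h3
    exact h3 rfl
  · rw [h, val_neg, hj]
    push_cast
    rw [h1, h2]
    intro h
    rw [← h, Int.natAbs_neg] at h3
    exact h3 rfl

/-- Compared entries have distinct absolute values, so every index is either an ascent or a descent.
-/
theorem weight_eq_prefixWeight (s₀ s₁ t₀ t₁ : K) {n : ℕ} (π : SignedPerm (n + 2)) :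
    s₀ ^ π.easc * s₁ ^ π.oasc * t₀ ^ π.edes * t₁ ^ π.odes =
      prefixWeight (byParity t₀ t₁) (byParity (s₀ - t₀) (s₁ - t₁)) (n + 2) π := by
  have h : s₀ ^ π.easc * s₁ ^ π.oasc * t₀ ^ π.edes * t₁ ^ π.odes =
      ∏ i ∈ indices (n + 2), if π.val i < π.val (|i| + 1) then (if Even i then s₀ else s₁)
        else (if Even i then t₀ else t₁) := by
    unfold easc oasc edes odes ascSet desSet
    simp only [← prod_const, prod_filter, ← prod_mul_distrib]
    refine prod_congr rfl fun i hi => ?_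
    have h1 := val_ne_of_mem_indices π hi
    rcases Int.even_or_odd i with h2 | h2
    · have h3 : ¬ Odd i := Int.not_odd_iff_even.2 h2
      rcases lt_or_gt_of_ne h1 with h | h
      · simp [h, h2, h3, h.not_gt]
      · simp [h, h2, h3, h.not_gt]
    · have h3 : ¬ Even i := Int.not_even_iff_odd.2 h2
      rcases lt_or_gt_of_ne h1 with h | h
      · simp [h, h2, h3, h.not_gt]
      · simp [h, h2, h3, h.not_gt]
  rw [h, prod_indices, prefixWeight]
  congr 1
  · rw [val_neg, ascIndNeg]
    simp only [byParity]
    norm_num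
    split_ifs <;> ring
  · refine prod_congr rfl fun i hi => ?_
    simp only [ascInd, byParity, Int.even_coe_nat, Nat.abs_cast, Nat.cast_add, Nat.cast_one]
    split_ifs <;> ring

theorem two_mul_fiveVar (s₀ s₁ t₀ t₁ q : K) (n : ℕ) :
    ∑ π : SignedPerm (n + 2),
      prefixWeight (byParity t₀ t₁) (byParity (s₀ - t₀) (s₁ - t₁)) (n + 2) π * q ^ π.inv =
    2 * fiveVar (n + 2) s₀ s₁ t₀ t₁ q := by
  rw [sum_eq_two_mul_sum_group _ fun π => by rw [prefixWeight_negOne, inv_negOne]]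
  unfold fiveVar
  simp only [weight_eq_prefixWeight]

/-- Length zero must be excluded: the only element there has no entry to negate, and `eulerian_zero`
treats it separately. -/
theorem two_mul_eulerian (q : K) (n : ℕ) :
    ∏ i ∈ range (n + 1), qInt q (i + 1) * (1 + q ^ i) = 2 * eulerian (n + 1) 1 q := by
  rw [← sum_pow_inv, sum_eq_two_mul_sum_group _ fun π => by rw [inv_negOne]]
  simp [eulerian]

theorem eulerian_zero (t q : K) : eulerian 0 t q = 1 := by
  have : group 0 = {1} := by
    ext π
    simp [group, Subsingleton.elim π 1]
  have h : des (1 : SignedPerm 0) = 0 := by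
    rw [des, desSet, card_eq_zero, filter_eq_empty_iff]
    intro i hi
    simp only [indices, mem_filter, mem_Icc] at hi
    have := abs_nonneg i
    omega
  simp [eulerian, this, h, inv_eq_wordInv, wordInv]

theorem qInt_two_mul (q : K) (n : ℕ) : qInt q (2 * n) = qInt q n * (1 + q ^ n) := by
  rw [qInt, two_mul, sum_range_add]
  simp only [pow_add, ← mul_sum]
  rw [← qInt]
  ring

/-- For positive exponents, `1 + q^n` divides `[2n]_q`; at exponent zero it is `2`. -/
theorem one_add_pow_ne_zero [CharZero K] {q : K} (hq : ∀ n : ℕ, 1 ≤ n → qInt q n ≠ 0) (n : ℕ) :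
    1 + q ^ n ≠ 0 := by
  rcases n with _ | n
  · norm_num
  · have := hq (2 * (n + 1)) (by omega)
    rw [qInt_two_mul] at this
    exact right_ne_zero_of_mul this

theorem prod_qInt_ne_zero [CharZero K] {q : K} (hq : ∀ n : ℕ, 1 ≤ n → qInt q n ≠ 0)
    (s : Finset ℕ) : ∏ i ∈ s, qInt q (i + 1) * (1 + q ^ i) ≠ 0 :=
  prod_ne_zero_iff.2 fun i _ => mul_ne_zero (hq _ (by omega)) (one_add_pow_ne_zero hq i)

theorem eulerian_ne_zero [CharZero K] {q : K} (hq : ∀ n : ℕ, 1 ≤ n → qInt q n ≠ 0) (n : ℕ) :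
    eulerian n 1 q ≠ 0 := by
  rcases n with _ | n
  · rw [eulerian_zero]
    exact one_ne_zero
  · have := two_mul_eulerian q n ▸ prod_qInt_ne_zero hq (range (n + 1))
    exact right_ne_zero_of_mul this

theorem qFact_ne_zero {q : K} (hq : ∀ n : ℕ, 1 ≤ n → qInt q n ≠ 0) (n : ℕ) :
    qFact q n ≠ 0 :=
  prod_ne_zero_iff.2 fun i hi => hq i (mem_Icc.1 hi).1

/-! ### The last-cut expansion and the recurrence -/

/-- Expansion of `∏ (t_k + x_k)` by the last factor from which `t_k` is chosen; the earlier factors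
stay unexpanded in `P k`. -/
theorem eq_prod_add_sum (P t x : ℕ → K) (hP : ∀ k, 2 ≤ k → P (k + 1) = P k * (t k + x k)) (n : ℕ) :
    P (n + 2) = P 2 * ∏ i ∈ Ico 2 (n + 2), x i +
      ∑ k ∈ Ico 2 (n + 2), P k * t k * ∏ i ∈ Ico (k + 1) (n + 2), x i := by
  induction n with
  | zero => simp
  | succ n ih =>
    rw [show n + 1 + 2 = n + 2 + 1 from rfl, sum_Ico_succ_top (by omega),
      prod_Ico_succ_top (by omega)]
    have : ∑ k ∈ Ico 2 (n + 2), P k * t k * ∏ i ∈ Ico (k + 1) (n + 2 + 1), x i =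
        (∑ k ∈ Ico 2 (n + 2), P k * t k * ∏ i ∈ Ico (k + 1) (n + 2), x i) * x (n + 2) := by
      rw [sum_mul]
      refine sum_congr rfl fun k hk => ?_
      rw [mem_Ico] at hk
      rw [prod_Ico_succ_top (by omega)]
      ring
    rw [this, hP _ (by omega), Ico_self, prod_empty]
    linear_combination x (n + 2) * ih

theorem prefixWeight_succ (t c : ℕ → K) {n k : ℕ} (hk : 1 ≤ k) (π : SignedPerm n) :
    prefixWeight t c (k + 1) π = prefixWeight t c k π * (t k + c k * ascInd K π k) := by
  rw [prefixWeight, prefixWeight, prod_Ico_succ_top hk, mul_assoc]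

variable [CharZero K] {q : K}

theorem sum_prod_ascInd (hq : ∀ n : ℕ, 1 ≤ n → qInt q n ≠ 0) {k m n : ℕ} (h : k + m = n + 1) :
    ∑ π : SignedPerm (n + 1), (∏ i ∈ Ico (k + 1) (n + 1), ascInd K π i) * q ^ π.inv =
      2 * eulerian (n + 1) 1 q / qFact q m := by
  rw [eq_div_iff (qFact_ne_zero hq m), ← two_mul_eulerian, ← sum_pow_inv, ← h]
  have := sum_pow_inv_sort q (k := k) (m := m) (fun _ => 1) fun _ _ => rfl
  simp only [one_mul] at this
  rw [this, mul_comm]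

/-- Dropping the condition on the tail costs `[m]_q!`. The tail entries can then be removed one at a
time, and their factors make up the quotient of `D_{k+m}(1,q)` by `D_k(1,q)`. -/
theorem sum_prefixWeight_mul_prod (hq : ∀ n : ℕ, 1 ≤ n → qInt q n ≠ 0) (s₀ s₁ t₀ t₁ : K)
    {k m n : ℕ} (hk : 2 ≤ k) (h : k + m = n + 1) :
    ∑ π : SignedPerm (n + 1),
      prefixWeight (byParity t₀ t₁) (byParity (s₀ - t₀) (s₁ - t₁)) k π *
        (∏ i ∈ Ico (k + 1) (n + 1), ascInd K π i) * q ^ π.inv =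
      2 * eulerian (n + 1) 1 q * (fiveVar k s₀ s₁ t₀ t₁ q / eulerian k 1 q) / qFact q m := by
  rw [eq_div_iff (qFact_ne_zero hq m), ← two_mul_eulerian, ← h]
  have h1 := sum_pow_inv_sort q
    (prefixWeight (byParity t₀ t₁) (byParity (s₀ - t₀) (s₁ - t₁)) k (n := k + m))
    (prefixWeight_rearrange _ _ hk)
  rw [sum_prefixWeight q _ _ hk] at h1
  obtain ⟨k, rfl⟩ := Nat.exists_eq_add_of_le' hk
  rw [two_mul_fiveVar] at h1
  have h2 := two_mul_eulerian q (k + 1)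
  rw [mul_comm, ← h1, ← prod_range_mul_prod_Ico _ (by omega : k + 2 ≤ k + 2 + m), h2]
  field_simp [eulerian_ne_zero hq]

theorem fiveVar_div_eulerian (hq : ∀ n : ℕ, 1 ≤ n → qInt q n ≠ 0) (s₀ s₁ t₀ t₁ : K) (n : ℕ) :
    fiveVar (n + 2) s₀ s₁ t₀ t₁ q / eulerian (n + 2) 1 q =
      (∏ i ∈ Ico 2 (n + 2), byParity (s₀ - t₀) (s₁ - t₁) i) *
        (t₁ ^ 2 / qFact q (n + 1) + 2 * t₁ * (s₁ - t₁) / qFact q (n + 2) +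
          (s₁ - t₁) ^ 2 / eulerian (n + 2) 1 q) +
      ∑ k ∈ Ico 2 (n + 2), fiveVar k s₀ s₁ t₀ t₁ q / eulerian k 1 q * byParity t₀ t₁ k *
        (∏ i ∈ Ico (k + 1) (n + 2), byParity (s₀ - t₀) (s₁ - t₁) i) / qFact q (n + 2 - k) := by
  set c := byParity (s₀ - t₀) (s₁ - t₁) with hc
  set t := byParity t₀ t₁ with ht
  have hE := eulerian_ne_zero hq (n + 2)
  have hc1 : c 1 = s₁ - t₁ := by simp [hc, byParity]
  have ht1 : t 1 = t₁ := by simp [ht, byParity]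
  have h1 := two_mul_fiveVar s₀ s₁ t₀ t₁ q n
  rw [← hc, ← ht] at h1
  have h2 : ∀ π : SignedPerm (n + 2), prefixWeight t c (n + 2) π * q ^ π.inv =
      (∏ i ∈ Ico 2 (n + 2), c i) *
        (t₁ ^ 2 * ((∏ i ∈ Ico 2 (n + 2), ascInd K π i) * q ^ π.inv) +
        t₁ * (s₁ - t₁) * ((∏ i ∈ Ico 1 (n + 2), ascInd K π i) * q ^ π.inv) +
        t₁ * (s₁ - t₁) * (ascIndNeg K π * (∏ i ∈ Ico 2 (n + 2), ascInd K π i) * q ^ π.inv) +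
        (s₁ - t₁) ^ 2 *
          (ascIndNeg K π * (∏ i ∈ Ico 1 (n + 2), ascInd K π i) * q ^ π.inv)) +
      ∑ k ∈ Ico 2 (n + 2), t k * (∏ i ∈ Ico (k + 1) (n + 2), c i) *
        (prefixWeight t c k π * (∏ i ∈ Ico (k + 1) (n + 2), ascInd K π i) * q ^ π.inv) := by
    intro π
    rw [eq_prod_add_sum (fun k => prefixWeight t c k π) t (fun i => c i * ascInd K π i)
      (fun k hk => prefixWeight_succ t c (by omega) π) n, add_mul, sum_mul]
    congr 1
    · simp only [prod_mul_distrib]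
      -- The uncut part is `(t₁ + c₁·asc₋₁)(t₁ + c₁·asc₁)` times the ascents from index `2` on,
      -- which gives the four terms.
      rw [prefixWeight, prod_eq_prod_Ico_succ_bot (by omega : 1 < n + 2), hc1, ht1]
      simp [ht1, hc1]
      ring
    · refine sum_congr rfl fun k _ => ?_
      rw [prod_mul_distrib]
      ring
  rw [sum_congr rfl fun π _ => h2 π, sum_add_distrib, ← mul_sum, sum_add_distrib, sum_add_distrib,
    sum_add_distrib, ← mul_sum, ← mul_sum, ← mul_sum, ← mul_sum, sum_ascIndNeg_mul_prod,
    sum_ascIndNeg, sum_comm] at h1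
  simp only [← mul_sum] at h1
  -- Ascents from index `2` on order the last `n + 1` entries; ascents from index `1` on order all
  -- `n + 2`.
  rw [sum_prod_ascInd hq (k := 1) (m := n + 1) (by omega),
    sum_prod_ascInd hq (k := 0) (m := n + 2) (by omega)] at h1
  have h3 : ∑ k ∈ Ico 2 (n + 2), t k * (∏ i ∈ Ico (k + 1) (n + 2), c i) *
      ∑ π : SignedPerm (n + 2),
        prefixWeight t c k π * (∏ i ∈ Ico (k + 1) (n + 2), ascInd K π i) * q ^ π.inv =
      2 * eulerian (n + 2) 1 q * ∑ k ∈ Ico 2 (n + 2),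
        fiveVar k s₀ s₁ t₀ t₁ q / eulerian k 1 q * t k *
        (∏ i ∈ Ico (k + 1) (n + 2), c i) / qFact q (n + 2 - k) := by
    rw [mul_sum]
    refine sum_congr rfl fun k hk => ?_
    rw [mem_Ico] at hk
    rw [sum_prefixWeight_mul_prod hq s₀ s₁ t₀ t₁ (n := n + 1) (m := n + 2 - k) hk.1 (by omega)]
    ring
  rw [h3] at h1
  have h4 : (2 : K) * eulerian (n + 2) 1 q ≠ 0 := mul_ne_zero two_ne_zero hE
  rw [div_eq_iff hE]
  refine mul_left_cancel₀ (two_ne_zero (α := K)) ?_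
  rw [← h1]
  have h5 := qFact_ne_zero hq (n + 1)
  have h6 := qFact_ne_zero hq (n + 2)
  field_simp
  ring

end Field

/-! ### Parity products and the coefficients of the series -/

section Field

variable {K : Type*} [Field K]

theorem byParity_mul_succ {a b x : K} (h : x ^ 2 = a * b) (i : ℕ) :
    byParity a b i * byParity a b (i + 1) = x ^ 2 := by
  rw [h]
  unfold byParity
  by_cases hi : Even i
  · simp [hi, Nat.even_add_one]
  · simp [hi, Nat.even_add_one, mul_comm]

theorem prod_byParity_even {a b x : K} (h : x ^ 2 = a * b) (k l : ℕ) :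
    ∏ i ∈ Ico k (k + 2 * l), byParity a b i = x ^ (2 * l) := by
  induction l with
  | zero => simp
  | succ l ih =>
    rw [show k + 2 * (l + 1) = k + 2 * l + 1 + 1 by ring, prod_Ico_succ_top (by omega),
      prod_Ico_succ_top (by omega), ih, mul_assoc, byParity_mul_succ h]
    ring

theorem prod_byParity_odd {a b x : K} (h : x ^ 2 = a * b) (k l : ℕ) :
    ∏ i ∈ Ico k (k + (2 * l + 1)), byParity a b i = x ^ (2 * l) * byParity a b k := by
  rw [← add_assoc, prod_Ico_succ_top (by omega), prod_byParity_even h]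
  simp [byParity, Nat.even_add]

/-- Consecutive factors pair up to `x²`. There are `j - 1` of them: for even `j` the factor at `k`
completes the pairing, and for odd `j` they pair exactly. -/
theorem prod_byParity {a b x : K} (h : x ^ 2 = a * b) (ha : a ≠ 0) (hb : b ≠ 0) (hx : x ≠ 0)
    (k : ℕ) {j : ℕ} (hj : 1 ≤ j) : ∏ i ∈ Ico (k + 1) (k + j), byParity a b i =
      if Even j then x ^ j / byParity a b k else x ^ j / x := by
  have hk : byParity a b k ≠ 0 := by
    unfold byParity
    split_ifs <;> assumption
  split_ifs with he
  · obtain ⟨l, hl⟩ := even_iff_exists_two_mul.1 he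
    obtain ⟨l, rfl⟩ := Nat.exists_eq_add_of_le' (show 1 ≤ l by omega)
    rw [show k + j = k + 1 + (2 * l + 1) by omega, prod_byParity_odd h, eq_div_iff hk, hl,
      mul_assoc, mul_comm (byParity a b (k + 1)), byParity_mul_succ h]
    ring
  · obtain ⟨l, rfl⟩ := Nat.not_even_iff_odd.1 he
    rw [show k + (2 * l + 1) = k + 1 + 2 * l by omega, prod_byParity_even h, eq_div_iff hx,
      pow_succ]

theorem coeff_evenPart [CharZero K] (f : K⟦X⟧) (n : ℕ) :
    coeff n (evenPart f) = if Even n then coeff n f else 0 := by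
  rw [evenPart, coeff_C_mul, map_add, coeff_rescale]
  split_ifs with h
  · rw [h.neg_one_pow]
    ring
  · rw [(Nat.not_even_iff_odd.1 h).neg_one_pow]
    ring

theorem coeff_oddPart [CharZero K] (f : K⟦X⟧) (n : ℕ) :
    coeff n (oddPart f) = if Even n then 0 else coeff n f := by
  rw [oddPart, coeff_C_mul, map_sub, coeff_rescale]
  split_ifs with h
  · rw [h.neg_one_pow]
    ring
  · rw [(Nat.not_even_iff_odd.1 h).neg_one_pow]
    ring

theorem evenPart_add_oddPart [CharZero K] (f : K⟦X⟧) : evenPart f + oddPart f = f := by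
  ext n
  rw [map_add, coeff_evenPart, coeff_oddPart]
  split_ifs <;> simp

theorem rescale_neg_eq [CharZero K] (f : K⟦X⟧) (x : K) :
    rescale (-x) f = rescale x (evenPart f) - rescale x (oddPart f) := by
  ext n
  rw [map_sub, coeff_rescale, coeff_rescale, coeff_rescale, coeff_evenPart, coeff_oddPart]
  split_ifs with h
  · rw [h.neg_pow]
    ring
  · rw [(Nat.not_even_iff_odd.1 h).neg_pow]
    ring

theorem rescale_expq_mul [CharZero K] (q m : K) :
    rescale m (expq q) * rescale (-m) (expq q) =
      rescale m (coshq q) ^ 2 - rescale m (sinhq q) ^ 2 := by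
  rw [rescale_neg_eq, coshq, sinhq]
  nth_rewrite 1 [← evenPart_add_oddPart (expq q)]
  rw [map_add]
  ring

theorem qFact_zero (q : K) : qFact q 0 = 1 := by simp [qFact]

theorem qFact_one (q : K) : qFact q 1 = 1 := by simp [qFact, qInt]

theorem eulerian_one [CharZero K] (q : K) : eulerian 1 1 q = 1 := by
  have := two_mul_eulerian q 0
  simp [qInt] at this
  have h2 : (2 : K) ≠ 0 := two_ne_zero
  refine mul_left_cancel₀ h2 ?_
  rw [← this]
  norm_num

theorem coeff_coshq [CharZero K] (q m : K) (n : ℕ) :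
    coeff n (rescale m (coshq q)) = if Even n then m ^ n / qFact q n else 0 := by
  rw [coeff_rescale, coshq, coeff_evenPart, expq, coeff_mk]
  split_ifs <;> ring

theorem coeff_sinhq [CharZero K] (q m : K) (n : ℕ) :
    coeff n (rescale m (sinhq q)) = if Even n then 0 else m ^ n / qFact q n := by
  rw [coeff_rescale, sinhq, coeff_oddPart, expq, coeff_mk]
  split_ifs <;> ring

theorem coeff_coshD [CharZero K] (q m : K) (n : ℕ) :
    coeff n (rescale m (coshD q)) = if Even n then m ^ n / eulerian n 1 q else 0 := by
  rw [coeff_rescale, coshD, coeff_evenPart, expD, coeff_mk]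
  split_ifs <;> ring

theorem coeff_sinhD [CharZero K] (q m : K) (n : ℕ) :
    coeff n (rescale m (sinhD q)) = if Even n then 0 else m ^ n / eulerian n 1 q := by
  rw [coeff_rescale, sinhD, coeff_oddPart, expD, coeff_mk]
  split_ifs <;> ring

theorem constantCoeff_denom [CharZero K] (s₀ s₁ t₀ t₁ q m : K) :
    constantCoeff (denom s₀ s₁ t₀ t₁ q m) = (s₀ - t₀) * (s₁ - t₁) := by
  have h1 := coeff_coshq q m 0
  have h2 : ∀ x : K, constantCoeff (rescale x (expq q)) = 1 := by
    intro x
    rw [← coeff_zero_eq_constantCoeff_apply, coeff_rescale, expq, coeff_mk, qFact_zero]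
    simp
  rw [coeff_zero_eq_constantCoeff_apply, qFact_zero] at h1
  simp only [denom, map_add, map_sub, map_mul, constantCoeff_C, h1, h2]
  simp
  ring

theorem rescale_C' (r a : K) : rescale r (C a) = C a := by
  ext n
  rw [coeff_rescale, coeff_C]
  split_ifs with h
  · simp [h]
  · simp

theorem TED_eq (s₀ s₁ t₀ t₁ q r m : K) (hs₀ : s₀ ≠ 0) (hs₁ : s₁ ≠ 0) (hm0 : m ≠ 0)
    (hr : r ^ 2 = s₀ * s₁) :
    TED s₀ s₁ t₀ t₁ q r m =
      C (2 * t₁ / s₁) * (rescale m (coshq q) - 1) +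
        C (t₁ ^ 2 * (s₀ - t₀) / (s₁ * m)) * X * rescale m (sinhq q) +
        C ((s₁ - t₁) / s₁) * (rescale m (coshD q) - 1) := by
  have hr0 : r ≠ 0 := by
    rintro rfl
    exact mul_ne_zero hs₀ hs₁ (by rw [← hr]; ring)
  have h : m / r * r = m := div_mul_cancel₀ m hr0
  have h1 : C (2 * (t₁ / s₁)) = (C (2 * t₁ / s₁) : K⟦X⟧) := by congr 1; ring
  have h2 : C ((t₁ / s₁) ^ 2 * (1 - t₀ / s₀) / (m / r)) * C r =
      (C (t₁ ^ 2 * (s₀ - t₀) / (s₁ * m)) : K⟦X⟧) := by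
    rw [← map_mul]
    congr 1
    field_simp
    rw [hr]
    ring
  have h3 : C (1 - t₁ / s₁) = (C ((s₁ - t₁) / s₁) : K⟦X⟧) := by congr 1; field_simp
  rw [TED, ED]
  simp only [map_add, map_mul, map_sub, map_one, rescale_C', rescale_rescale, rescale_X, h]
  rw [← h1, ← h2, ← h3]
  simp only [map_mul, map_sub, map_one]
  ring

theorem TOD_eq (s₀ s₁ t₀ t₁ q r m : K) (hs₀ : s₀ ≠ 0) (hs₁ : s₁ ≠ 0) (h₀ : s₀ ≠ t₀) (hm0 : m ≠ 0)
    (hr : r ^ 2 = s₀ * s₁) :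
    TOD s₀ s₁ t₀ t₁ q r m =
      C (r * t₁ ^ 2 / s₁ ^ 2) * X * (rescale m (coshq q) - 1) +
        C (s₀ * (s₁ - t₁) * m / (s₁ * (s₀ - t₀) * r)) * (rescale m (sinhD q) - C m * X) +
        C (2 * t₁ * (s₁ - t₁) * r / (s₁ ^ 2 * m)) * (rescale m (sinhq q) - C m * X) := by
  have hr0 : r ≠ 0 := by
    rintro rfl
    exact mul_ne_zero hs₀ hs₁ (by rw [← hr]; ring)
  have h : m / r * r = m := div_mul_cancel₀ m hr0
  have h0' : s₀ - t₀ ≠ 0 := sub_ne_zero.2 h₀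
  have h1 : C ((t₁ / s₁) ^ 2) * C r = (C (r * t₁ ^ 2 / s₁ ^ 2) : K⟦X⟧) := by
    rw [← map_mul]
    congr 1
    ring
  have h2 : C ((1 - t₁ / s₁) * (m / r) / (1 - t₀ / s₀)) =
      (C (s₀ * (s₁ - t₁) * m / (s₁ * (s₀ - t₀) * r)) : K⟦X⟧) := by
    congr 1
    field_simp
  have h3 : C (2 * (t₁ / s₁) * (1 - t₁ / s₁) / (m / r)) =
      (C (2 * t₁ * (s₁ - t₁) * r / (s₁ ^ 2 * m)) : K⟦X⟧) := by
    congr 1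
    field_simp
  have h4 : C (m / r) * C r = (C m : K⟦X⟧) := by rw [← map_mul, h]
  rw [TOD, OD, h2, h3]
  simp only [map_add, map_mul _ (C _), map_mul (rescale r), map_sub (rescale r), map_one,
    rescale_C', rescale_rescale, rescale_X, h]
  rw [← h1, ← h4]
  ring

/-! ### The recurrence as identities of power series -/

theorem sum_antidiagonal_eq_sum_Ico (n : ℕ) (U : ℕ → ℕ → K) :
    ∑ p ∈ antidiagonal n, (if 2 ≤ p.1 ∧ 1 ≤ p.2 then U p.1 p.2 else 0) =
      ∑ k ∈ Ico 2 n, U k (n - k) := by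
  rw [Nat.sum_antidiagonal_eq_sum_range_succ fun k j => if 2 ≤ k ∧ 1 ≤ j then U k j else 0,
    ← sum_filter]
  refine sum_congr ?_ fun _ _ => rfl
  ext k
  simp only [mem_filter, mem_range, mem_Ico]
  omega

theorem coeff_egfEven (s₀ s₁ t₀ t₁ q : K) (n : ℕ) :
    coeff n (egfEven s₀ s₁ t₀ t₁ q) =
      if Even n ∧ 2 ≤ n then fiveVar n s₀ s₁ t₀ t₁ q / eulerian n 1 q else 0 := by
  rw [egfEven, coeff_mk]

theorem coeff_egfOdd (s₀ s₁ t₀ t₁ q : K) (n : ℕ) :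
    coeff n (egfOdd s₀ s₁ t₀ t₁ q) =
      if ¬ Even n ∧ 2 ≤ n then fiveVar n s₀ s₁ t₀ t₁ q / eulerian n 1 q else 0 := by
  rw [egfOdd, coeff_mk]
  refine if_congr ?_ rfl rfl
  rw [Nat.not_even_iff_odd]
  refine and_congr_right fun h => ?_
  have := h.pos
  rcases h with ⟨k, rfl⟩
  omega

theorem coeff_coshq_sub_one [CharZero K] (q m : K) (n : ℕ) :
    coeff n (rescale m (coshq q) - 1) = if Even n ∧ 1 ≤ n then m ^ n / qFact q n else 0 := by
  rw [map_sub, coeff_coshq, coeff_one]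
  rcases n with _ | n
  · simp [qFact_zero]
  · simp

theorem coeff_mul_C_mul (f g : K⟦X⟧) (a : K) (n : ℕ) :
    coeff n (f * (C a * g)) = ∑ p ∈ antidiagonal n, coeff p.1 f * (a * coeff p.2 g) := by
  rw [coeff_mul]
  simp only [coeff_C_mul]

/-- The sum over the last cut, split by the parity of its position. -/
theorem coeff_convolution [CharZero K] {q : K} (s₀ s₁ t₀ t₁ m : K) (h₀ : s₀ - t₀ ≠ 0)
    (h₁ : s₁ - t₁ ≠ 0) (hm0 : m ≠ 0) (hm : m ^ 2 = (s₀ - t₀) * (s₁ - t₁)) (n : ℕ) :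
    coeff n (egfEven s₀ s₁ t₀ t₁ q * (C (t₀ / (s₀ - t₀)) * (rescale m (coshq q) - 1)) +
        egfOdd s₀ s₁ t₀ t₁ q * (C (t₁ / m) * rescale m (sinhq q))) =
      (if Even n then ∑ k ∈ Ico 2 n, fiveVar k s₀ s₁ t₀ t₁ q / eulerian k 1 q * byParity t₀ t₁ k *
        (∏ i ∈ Ico (k + 1) n, byParity (s₀ - t₀) (s₁ - t₁) i) / qFact q (n - k) else 0) ∧
    coeff n (egfEven s₀ s₁ t₀ t₁ q * (C (t₀ / m) * rescale m (sinhq q)) +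
        egfOdd s₀ s₁ t₀ t₁ q * (C (t₁ / (s₁ - t₁)) * (rescale m (coshq q) - 1))) =
      (if Even n then 0 else ∑ k ∈ Ico 2 n, fiveVar k s₀ s₁ t₀ t₁ q / eulerian k 1 q *
        byParity t₀ t₁ k * (∏ i ∈ Ico (k + 1) n, byParity (s₀ - t₀) (s₁ - t₁) i) /
          qFact q (n - k)) := by
  have key : ∀ k j : ℕ, k + j = n → 1 ≤ j →
      ∏ i ∈ Ico (k + 1) n, byParity (s₀ - t₀) (s₁ - t₁) i =
      if Even j then m ^ j / byParity (s₀ - t₀) (s₁ - t₁) k else m ^ j / m := by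
    rintro k j rfl hj
    exact prod_byParity hm h₀ h₁ hm0 k hj
  have h := sum_antidiagonal_eq_sum_Ico n fun k j =>
    fiveVar k s₀ s₁ t₀ t₁ q / eulerian k 1 q * byParity t₀ t₁ k *
        (∏ i ∈ Ico (k + 1) n, byParity (s₀ - t₀) (s₁ - t₁) i) / qFact q j
  -- Moving the parity condition on `n` inside the sum reduces both identities to a termwise check
  -- on the parities of `k` and `j`.
  rw [← h, ← sum_const_zero (s := antidiagonal n), ← sum_ite_irrel, ← sum_ite_irrel]
  simp only [map_add, coeff_mul_C_mul, coeff_egfEven, coeff_egfOdd, coeff_coshq_sub_one,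
    coeff_sinhq, ← sum_add_distrib]
  constructor
  all_goals
    refine sum_congr rfl ?_
    rintro ⟨k, j⟩ hkj
    rw [HasAntidiagonal.mem_antidiagonal] at hkj
    simp only at hkj ⊢
    have hpar : Even n ↔ (Even k ↔ Even j) := by rw [← hkj, Nat.even_add]
    by_cases hj : 1 ≤ j
    · by_cases hk : 2 ≤ k
      · simp only [key k j hkj hj]
        by_cases hke : Even k <;> by_cases hje : Even j <;>
          simp only [hpar, hke, hje, hj, hk, byParity, and_self, and_true, if_true,
            if_false, not_true_eq_false, not_false_eq_true, iff_false, iff_true] <;>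
          ring
      · simp [hk]
    · have : j = 0 := by omega
      subst this
      simp

/-- `T(ED)` collects the uncut terms of even length: `u·sinh_q`, `cosh_q` and `cosh_D` account for
the denominators `[n-1]_q!`, `[n]_q!` and `D_n(1,q)`. -/
theorem coeff_C_mul_TED [CharZero K] {q : K} (hq : ∀ n : ℕ, 1 ≤ n → qInt q n ≠ 0)
    (s₀ s₁ t₀ t₁ r m : K) (hs₀ : s₀ ≠ 0) (hs₁ : s₁ ≠ 0) (h₀ : s₀ - t₀ ≠ 0) (hm0 : m ≠ 0)
    (hr : r ^ 2 = s₀ * s₁) (hm : m ^ 2 = (s₀ - t₀) * (s₁ - t₁)) (n : ℕ) :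
    coeff n (C (s₁ / (s₀ - t₀)) * TED s₀ s₁ t₀ t₁ q r m) =
      if Even n ∧ 2 ≤ n then (∏ i ∈ Ico 2 n, byParity (s₀ - t₀) (s₁ - t₁) i) *
        (t₁ ^ 2 / qFact q (n - 1) + 2 * t₁ * (s₁ - t₁) / qFact q n +
          (s₁ - t₁) ^ 2 / eulerian n 1 q) else 0 := by
  rw [TED_eq s₀ s₁ t₀ t₁ q r m hs₀ hs₁ hm0 hr]
  simp only [coeff_C_mul, map_add, mul_assoc (C _), map_sub, coeff_coshq, coeff_coshD]
  rcases n with _ | n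
  · simp [eulerian_zero, qFact_zero]
  rw [coeff_succ_X_mul, coeff_sinhq, coeff_one, Nat.add_sub_cancel]
  rcases n with _ | n
  · simp
  rw [show n + 1 + 1 = n + 2 from rfl]
  by_cases he : Even n
  · have he2 : Even (n + 2) := by simpa [Nat.even_add] using he
    have he1 : ¬ Even (n + 1) := by simpa [Nat.even_add_one] using he
    have h4 := qFact_ne_zero hq (n + 1)
    have h5 := qFact_ne_zero hq (n + 2)
    have h6 := eulerian_ne_zero hq (n + 2)
    have h7 : m ^ (n + 2) = m ^ n * ((s₀ - t₀) * (s₁ - t₁)) := by rw [← hm]; ring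
    have h8 : m ^ (n + 1) = m ^ n * m := by ring
    have h9 : ∏ i ∈ Ico 2 (n + 2), byParity (s₀ - t₀) (s₁ - t₁) i = m ^ n := by
      obtain ⟨l, rfl⟩ := even_iff_exists_two_mul.1 he
      rw [add_comm (2 * l) 2, prod_byParity_even hm]
    rw [if_pos he2, if_neg he1, if_neg (by omega), if_pos he2, if_pos ⟨he2, by omega⟩, h7, h8, h9]
    field_simp
    ring
  · have he2 : ¬ Even (n + 2) := by simpa [Nat.even_add] using he
    have he1 : Even (n + 1) := by simpa [Nat.even_add_one] using he
    simp [he2, he1]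

theorem coeff_C_mul_TOD [CharZero K] {q : K} (hq : ∀ n : ℕ, 1 ≤ n → qInt q n ≠ 0)
    (s₀ s₁ t₀ t₁ r m : K) (hs₀ : s₀ ≠ 0) (hs₁ : s₁ ≠ 0) (h₀ : s₀ - t₀ ≠ 0) (h₁ : s₁ - t₁ ≠ 0)
    (hm0 : m ≠ 0) (hr : r ^ 2 = s₀ * s₁) (hm : m ^ 2 = (s₀ - t₀) * (s₁ - t₁)) (n : ℕ) :
    coeff n (C (s₁ * r / (s₀ * (s₁ - t₁))) * TOD s₀ s₁ t₀ t₁ q r m) =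
      if ¬ Even n ∧ 2 ≤ n then (∏ i ∈ Ico 2 n, byParity (s₀ - t₀) (s₁ - t₁) i) *
        (t₁ ^ 2 / qFact q (n - 1) + 2 * t₁ * (s₁ - t₁) / qFact q n +
          (s₁ - t₁) ^ 2 / eulerian n 1 q) else 0 := by
  have hr0 : r ≠ 0 := by
    rintro rfl
    exact mul_ne_zero hs₀ hs₁ (by rw [← hr]; ring)
  rw [TOD_eq s₀ s₁ t₀ t₁ q r m hs₀ hs₁ (sub_ne_zero.1 h₀) hm0 hr]
  simp only [coeff_C_mul, map_add, mul_assoc (C _), map_sub (coeff _) (rescale m (sinhq q)),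
    map_sub (coeff _) (rescale m (sinhD q)), coeff_sinhq, coeff_sinhD, coeff_X]
  rcases n with _ | n
  · simp
  rw [coeff_succ_X_mul, coeff_coshq_sub_one, Nat.add_sub_cancel]
  rcases n with _ | n
  -- The subtracted terms `mu` cancel the linear coefficients, as `[1]_q! = D_1(1,q) = 1`.
  · simp [eulerian_one, qFact_one]
  rw [show n + 1 + 1 = n + 2 from rfl]
  by_cases he : Even n
  · have he2 : Even (n + 2) := by simpa [Nat.even_add] using he
    have he1 : ¬ Even (n + 1) := by simpa [Nat.even_add_one] using he
    simp [he2, he1]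
  · have he2 : ¬ Even (n + 2) := by simpa [Nat.even_add] using he
    have he1 : Even (n + 1) := by simpa [Nat.even_add_one] using he
    have h4 := qFact_ne_zero hq (n + 1)
    have h5 := qFact_ne_zero hq (n + 2)
    have h6 := eulerian_ne_zero hq (n + 2)
    rw [if_pos ⟨he1, by omega⟩, if_neg he2, if_neg (by omega), if_neg he2,
      if_pos ⟨he2, by omega⟩]
    obtain ⟨l, rfl⟩ := Nat.not_even_iff_odd.1 he
    have h7 : m ^ (2 * l + 1 + 2) = m ^ (2 * l) * ((s₀ - t₀) * (s₁ - t₁)) * m := by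
      rw [← hm]
      ring
    have h8 : m ^ (2 * l + 1 + 1) = m ^ (2 * l) * ((s₀ - t₀) * (s₁ - t₁)) := by
      rw [← hm]
      ring
    have h9 : ∏ i ∈ Ico 2 (2 * l + 1 + 2), byParity (s₀ - t₀) (s₁ - t₁) i =
        m ^ (2 * l) * (s₀ - t₀) := by
      rw [add_comm (2 * l + 1) 2, prod_byParity_odd hm]
      simp [byParity]
    rw [h7, h8, h9, mul_zero, sub_zero, sub_zero]
    have h10 : s₁ * r / (s₀ * (s₁ - t₁)) * (r * t₁ ^ 2 / s₁ ^ 2 *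
        (m ^ (2 * l) * ((s₀ - t₀) * (s₁ - t₁)) / qFact q (2 * l + 1 + 1))) =
        m ^ (2 * l) * (s₀ - t₀) * (t₁ ^ 2 / qFact q (2 * l + 1 + 1)) := by
      field_simp
      rw [hr]
      ring
    have h11 : s₁ * r / (s₀ * (s₁ - t₁)) * (s₀ * (s₁ - t₁) * m / (s₁ * (s₀ - t₀) * r) *
        (m ^ (2 * l) * ((s₀ - t₀) * (s₁ - t₁)) * m / eulerian (2 * l + 1 + 2) 1 q)) =
        m ^ (2 * l) * (s₀ - t₀) * ((s₁ - t₁) ^ 2 / eulerian (2 * l + 1 + 2) 1 q) := by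
      field_simp
      rw [hm]
      ring
    have h12 : s₁ * r / (s₀ * (s₁ - t₁)) * (2 * t₁ * (s₁ - t₁) * r / (s₁ ^ 2 * m) *
        (m ^ (2 * l) * ((s₀ - t₀) * (s₁ - t₁)) * m / qFact q (2 * l + 1 + 2))) =
        m ^ (2 * l) * (s₀ - t₀) * (2 * t₁ * (s₁ - t₁) / qFact q (2 * l + 1 + 2)) := by
      field_simp
      rw [hr]
      ring
    rw [mul_add, mul_add, h10, h11, h12]
    ring

theorem egfEven_eq [CharZero K] {q : K} (hq : ∀ n : ℕ, 1 ≤ n → qInt q n ≠ 0) (s₀ s₁ t₀ t₁ r m : K)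
    (hs₀ : s₀ ≠ 0) (hs₁ : s₁ ≠ 0) (h₀ : s₀ - t₀ ≠ 0) (h₁ : s₁ - t₁ ≠ 0) (hm0 : m ≠ 0)
    (hr : r ^ 2 = s₀ * s₁) (hm : m ^ 2 = (s₀ - t₀) * (s₁ - t₁)) :
    egfEven s₀ s₁ t₀ t₁ q = C (s₁ / (s₀ - t₀)) * TED s₀ s₁ t₀ t₁ q r m +
      (egfEven s₀ s₁ t₀ t₁ q * (C (t₀ / (s₀ - t₀)) * (rescale m (coshq q) - 1)) +
        egfOdd s₀ s₁ t₀ t₁ q * (C (t₁ / m) * rescale m (sinhq q))) := by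
  ext n
  rw [map_add, (coeff_convolution s₀ s₁ t₀ t₁ m h₀ h₁ hm0 hm n).1, coeff_egfEven,
    coeff_C_mul_TED hq s₀ s₁ t₀ t₁ r m hs₀ hs₁ h₀ hm0 hr hm]
  by_cases he : Even n
  · by_cases hn : 2 ≤ n
    · rw [if_pos ⟨he, hn⟩, if_pos ⟨he, hn⟩, if_pos he]
      obtain ⟨n, rfl⟩ := Nat.exists_eq_add_of_le' hn
      exact fiveVar_div_eulerian hq s₀ s₁ t₀ t₁ n
    -- Below length `2` both sides vanish: the series start at length `2` and there is no position
    -- for a cut.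
    · simp [hn, Ico_eq_empty_of_le (not_le.1 hn).le]
  · simp [he]

theorem egfOdd_eq [CharZero K] {q : K} (hq : ∀ n : ℕ, 1 ≤ n → qInt q n ≠ 0) (s₀ s₁ t₀ t₁ r m : K)
    (hs₀ : s₀ ≠ 0) (hs₁ : s₁ ≠ 0) (h₀ : s₀ - t₀ ≠ 0) (h₁ : s₁ - t₁ ≠ 0) (hm0 : m ≠ 0)
    (hr : r ^ 2 = s₀ * s₁) (hm : m ^ 2 = (s₀ - t₀) * (s₁ - t₁)) :
    egfOdd s₀ s₁ t₀ t₁ q = C (s₁ * r / (s₀ * (s₁ - t₁))) * TOD s₀ s₁ t₀ t₁ q r m +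
      (egfEven s₀ s₁ t₀ t₁ q * (C (t₀ / m) * rescale m (sinhq q)) +
        egfOdd s₀ s₁ t₀ t₁ q * (C (t₁ / (s₁ - t₁)) * (rescale m (coshq q) - 1))) := by
  ext n
  rw [map_add, (coeff_convolution s₀ s₁ t₀ t₁ m h₀ h₁ hm0 hm n).2, coeff_egfOdd,
    coeff_C_mul_TOD hq s₀ s₁ t₀ t₁ r m hs₀ hs₁ h₀ h₁ hm0 hr hm]
  by_cases he : Even n
  · simp [he]
  · by_cases hn : 2 ≤ n
    · rw [if_pos ⟨he, hn⟩, if_pos ⟨he, hn⟩, if_neg he]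
      obtain ⟨n, rfl⟩ := Nat.exists_eq_add_of_le' hn
      exact fiveVar_div_eulerian hq s₀ s₁ t₀ t₁ n
    · simp [hn, Ico_eq_empty_of_le (not_le.1 hn).le]

/-- Cramer's rule for the system of `egfEven_eq` and `egfOdd_eq`. -/
theorem egf_mul_denom [CharZero K] {q : K} (hq : ∀ n : ℕ, 1 ≤ n → qInt q n ≠ 0)
    (s₀ s₁ t₀ t₁ r m : K) (hs₀ : s₀ ≠ 0) (hs₁ : s₁ ≠ 0) (h₀ : s₀ - t₀ ≠ 0) (h₁ : s₁ - t₁ ≠ 0)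
    (hm0 : m ≠ 0) (hr : r ^ 2 = s₀ * s₁) (hm : m ^ 2 = (s₀ - t₀) * (s₁ - t₁)) :
    egfEven s₀ s₁ t₀ t₁ q * denom s₀ s₁ t₀ t₁ q m =
      C s₁ * (TED s₀ s₁ t₀ t₁ q r m * (C s₁ - C t₁ * rescale m (coshq q)) +
        TOD s₀ s₁ t₀ t₁ q r m * (C (t₁ * (s₀ - t₀) * r / (m * s₀)) * rescale m (sinhq q))) ∧
    egfOdd s₀ s₁ t₀ t₁ q * denom s₀ s₁ t₀ t₁ q m =
      C (s₁ * r / s₀) * TOD s₀ s₁ t₀ t₁ q r m * (C s₀ - C t₀ * rescale m (coshq q)) +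
        TED s₀ s₁ t₀ t₁ q r m * (C (s₁ * t₀ * (s₁ - t₁) / m) * rescale m (sinhq q)) := by
  have e0 := egfEven_eq hq s₀ s₁ t₀ t₁ r m hs₀ hs₁ h₀ h₁ hm0 hr hm
  have e1 := egfOdd_eq hq s₀ s₁ t₀ t₁ r m hs₀ hs₁ h₀ h₁ hm0 hr hm
  have c1 : C (s₀ - t₀) * C (s₁ / (s₀ - t₀)) = (C s₁ : K⟦X⟧) := by
    rw [← map_mul, mul_div_cancel₀ _ h₀]
  have c2 : C (s₀ - t₀) * C (t₀ / (s₀ - t₀)) = (C t₀ : K⟦X⟧) := by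
    rw [← map_mul, mul_div_cancel₀ _ h₀]
  have c3 : C (s₁ - t₁) * C (t₁ / (s₁ - t₁)) = (C t₁ : K⟦X⟧) := by
    rw [← map_mul, mul_div_cancel₀ _ h₁]
  have c4 : C (s₁ - t₁) * C (s₁ * r / (s₀ * (s₁ - t₁))) = (C (s₁ * r / s₀) : K⟦X⟧) := by
    rw [← map_mul]
    congr 1
    field_simp
  have c5 : C (s₀ - t₀) * C (t₁ / m) * (C (s₁ - t₁) * C (t₀ / m)) = (C t₀ * C t₁ : K⟦X⟧) := by
    rw [← map_mul, ← map_mul, ← map_mul, ← map_mul]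
    congr 1
    field_simp
    rw [hm]
    ring
  have c6 : C s₁ * C (t₁ * (s₀ - t₀) * r / (m * s₀)) =
      (C (s₀ - t₀) * C (t₁ / m) * C (s₁ * r / s₀) : K⟦X⟧) := by
    rw [← map_mul, ← map_mul, ← map_mul]
    congr 1
    ring
  have c7 : C (s₁ * t₀ * (s₁ - t₁) / m) = (C (s₁ - t₁) * C (t₀ / m) * C s₁ : K⟦X⟧) := by
    rw [← map_mul, ← map_mul]
    congr 1
    ring
  have hd : denom s₀ s₁ t₀ t₁ q m = C s₀ * C s₁ -
      (C s₀ * C t₁ + C s₁ * C t₀) * rescale m (coshq q) +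
      C t₀ * C t₁ * (rescale m (coshq q) ^ 2 - rescale m (sinhq q) ^ 2) := by
    rw [denom, rescale_expq_mul]
    simp only [map_add, map_mul]
  have d0 : C (s₀ - t₀) = (C s₀ - C t₀ : K⟦X⟧) := map_sub _ _ _
  have d1 : C (s₁ - t₁) = (C s₁ - C t₁ : K⟦X⟧) := map_sub _ _ _
  set F := egfEven s₀ s₁ t₀ t₁ q
  set G := egfOdd s₀ s₁ t₀ t₁ q
  set A := TED s₀ s₁ t₀ t₁ q r m
  set B := TOD s₀ s₁ t₀ t₁ q r m
  set c := rescale m (coshq q)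
  set s := rescale m (sinhq q)
  -- Clearing `s₀ - t₀` and `s₁ - t₁` from the two equations gives the linear system in `F` and `G`.
  have f0 : (C s₀ - C t₀ * c) * F = C s₁ * A + C (s₀ - t₀) * C (t₁ / m) * s * G := by
    linear_combination C (s₀ - t₀) * e0 - F * d0 + A * c1 + F * (c - 1) * c2
  have f1 : (C s₁ - C t₁ * c) * G = C (s₁ * r / s₀) * B + C (s₁ - t₁) * C (t₀ / m) * s * F := by
    linear_combination C (s₁ - t₁) * e1 - G * d1 + B * c4 + G * (c - 1) * c3
  constructor
  · rw [hd]
    -- Elimination of `G`; `c5` turns the product of the off-diagonal coefficients into `t₀t₁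
    -- sinh_q²`.
    linear_combination (C s₁ - C t₁ * c) * f0 + C (s₀ - t₀) * C (t₁ / m) * s * f1 +
      s ^ 2 * F * c5 - B * s * c6
  · rw [hd]
    linear_combination (C s₀ - C t₀ * c) * f1 + C (s₁ - t₁) * C (t₀ / m) * s * f0 +
      s ^ 2 * G * c5 - A * s * c7

end Field

end TypeD

theorem mainTheorem10 {K : Type*} [Field K] [CharZero K] (s₀ s₁ t₀ t₁ q r m : K)
    (hs₀ : s₀ ≠ 0) (hs₁ : s₁ ≠ 0) (h₀ : s₀ ≠ t₀) (h₁ : s₁ ≠ t₁)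
    (hq : ∀ n : ℕ, 1 ≤ n → TypeD.qInt q n ≠ 0)
    (hr : r ^ 2 = s₀ * s₁) (hm : m ^ 2 = (s₀ - t₀) * (s₁ - t₁)) :
    (∀ n : ℕ, TypeD.eulerian n 1 q ≠ 0) ∧
    IsUnit (TypeD.denom s₀ s₁ t₀ t₁ q m) ∧
    TypeD.egfEven s₀ s₁ t₀ t₁ q =
      PowerSeries.C s₁ *
        (TypeD.TED s₀ s₁ t₀ t₁ q r m *
            (PowerSeries.C s₁ - PowerSeries.C t₁ * PowerSeries.rescale m (TypeD.coshq q)) +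
          TypeD.TOD s₀ s₁ t₀ t₁ q r m *
            (PowerSeries.C (t₁ * (s₀ - t₀) * r / (m * s₀)) *
              PowerSeries.rescale m (TypeD.sinhq q))) *
        (TypeD.denom s₀ s₁ t₀ t₁ q m)⁻¹ ∧
    TypeD.egfOdd s₀ s₁ t₀ t₁ q =
      (PowerSeries.C (s₁ * r / s₀) * TypeD.TOD s₀ s₁ t₀ t₁ q r m *
            (PowerSeries.C s₀ - PowerSeries.C t₀ * PowerSeries.rescale m (TypeD.coshq q)) +
          TypeD.TED s₀ s₁ t₀ t₁ q r m *
            (PowerSeries.C (s₁ * t₀ * (s₁ - t₁) / m) *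
              PowerSeries.rescale m (TypeD.sinhq q))) *
        (TypeD.denom s₀ s₁ t₀ t₁ q m)⁻¹ ∧
    TypeD.TOD s₀ s₁ t₀ t₁ q r m =
      PowerSeries.C (r * t₁ ^ 2 / s₁ ^ 2) * PowerSeries.X *
          (PowerSeries.rescale m (TypeD.coshq q) - 1) +
        PowerSeries.C (s₀ * (s₁ - t₁) * m / (s₁ * (s₀ - t₀) * r)) *
          (PowerSeries.rescale m (TypeD.sinhD q) - PowerSeries.C m * PowerSeries.X) +
        PowerSeries.C (2 * t₁ * (s₁ - t₁) * r / (s₁ ^ 2 * m)) *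
          (PowerSeries.rescale m (TypeD.sinhq q) - PowerSeries.C m * PowerSeries.X) ∧
    TypeD.TED s₀ s₁ t₀ t₁ q r m =
      PowerSeries.C (2 * t₁ / s₁) * (PowerSeries.rescale m (TypeD.coshq q) - 1) +
        PowerSeries.C (t₁ ^ 2 * (s₀ - t₀) / (s₁ * m)) * PowerSeries.X *
          PowerSeries.rescale m (TypeD.sinhq q) +
        PowerSeries.C ((s₁ - t₁) / s₁) * (PowerSeries.rescale m (TypeD.coshD q) - 1) := by
  have h₀' : s₀ - t₀ ≠ 0 := sub_ne_zero.2 h₀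
  have h₁' : s₁ - t₁ ≠ 0 := sub_ne_zero.2 h₁
  have hm0 : m ≠ 0 := by
    rintro rfl
    exact mul_ne_zero h₀' h₁' (by rw [← hm]; ring)
  have hc : PowerSeries.constantCoeff (TypeD.denom s₀ s₁ t₀ t₁ q m) ≠ 0 := by
    rw [TypeD.constantCoeff_denom]
    exact mul_ne_zero h₀' h₁'
  obtain ⟨he, ho⟩ := TypeD.egf_mul_denom hq s₀ s₁ t₀ t₁ r m hs₀ hs₁ h₀' h₁' hm0 hr hm
  refine ⟨TypeD.eulerian_ne_zero hq, ?_, ?_, ?_, ?_, ?_⟩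
  · exact PowerSeries.isUnit_iff_constantCoeff.2 hc.isUnit
  · exact (PowerSeries.eq_mul_inv_iff_mul_eq hc).2 he
  · exact (PowerSeries.eq_mul_inv_iff_mul_eq hc).2 ho
  · exact TypeD.TOD_eq s₀ s₁ t₀ t₁ q r m hs₀ hs₁ h₀ hm0 hr
  · exact TypeD.TED_eq s₀ s₁ t₀ t₁ q r m hs₀ hs₁ hm0 hr
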